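/- **Setting.** Fix a finite relational signature $\Sigma$ (each predicate $p$ has an arity $k_p\ge 0$; there is no equality symbol), a finite set $\mathrm{Agt}$ of agents and a countably infinite set of variables. *First-order epistemic formulas* are given by $$\varphi ::= p(x_1,\dots,x_{k_p}) \mid \neg\varphi \mid \varphi\wedge\varphi \mid \forall x\,\varphi \mid \Box_a\varphi \qquad (a\in \mathrm{Agt}).$$ A formula is *non-modal* if no $\Box_a$ occurs in it. An *epistemic model* $M$ over a non-empty domain $D$ consists of a set $W$ of worlds, a relation $R_a\subseteq W\times W$ for each agent $a$, and a $\Sigma$-structure $I_w$ with domain $D$ for each $w\in W$. For an assignment $\nu$ of elements of $D$ to the variables, $M,w\models_\nu\varphi$ is defined by the usual clauses: atoms are evaluated in $I_w$, quantifiers range over $D$, and $M,w\models_\nu\Box_a\varphi$ iff $M,w'\models_\nu\varphi$ for all $w'$ with $w\,R_a\,w'$. We write $M,w\models\varphi$ if $M,w\models_\nu\varphi$ for every $\nu$. An *action model* $E$ consists of a non-empty finite set $\mathcal E$ of events, a relation $Q_a\subseteq\mathcal E\times\mathcal E$ for each agent $a$, a closed formula $\mathrm{pre}(e)$ for each event $e$,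 and a formula $\mathrm{post}(e)(p)$, with free variables among $x_1,\dots,x_{k_p}$, for each event $e$ and predicate $p$. The *product update* $M\otimes E$ is the epistemic model over $D$ whose worlds are the pairs $(w,e)$ with $M,w\models\mathrm{pre}(e)$, in which $(w,e)$ is related to $(w',e')$ for agent $a$ iff $w\,R_a\,w'$ and $e\,Q_a\,e'$, and in which the interpretation of $p$ at $(w,e)$ is $\{(d_1,\dots,d_{k_p}) : M,w\models_{[x_i\mapsto d_i]}\mathrm{post}(e)(p)\}$. Put $M_0=M$ and $M_{k+1}=M_k\otimes E$. A *history* is a world $(\dots((w,e_1),e_2)\dots,e_k)$ of some $M_k$; it *starts from* $w$. The *epistemic model of histories* $ME^*$ is the disjoint union of all the $M_k$, $k\ge0$. The model $M$ is *automatic* if $W$ is finite and there are a finite alphabet $A$ and an injective map $\mathrm{enc}:D\to A^*$ such that $\mathrm{enc}(D)$ is a regular language and, for every world $w$ and predicate $p$, the set of the convolutions of the tuples $(\mathrm{enc}(d_1),\dots,\mathrm{enc}(d_{k_p}))$ with $(d_1,\dots,d_{k_p})$ in the interpretation of $p$ at $w$ is regular. (The convolution of words $u_1,\dots,u_k$ is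 the word over $(A\cup\{\#\})^k$ whose $j$-th letter is the tuple of the $j$-th letters of the $u_i$, shorter words being padded with $\#$.) Such a model is given as an input by the tables of its relations $R_a$, a finite automaton recognising $\mathrm{enc}(D)$ and, for each $w$ and $p$, a finite automaton that, among the convolutions of $k_p$-tuples of words of $\mathrm{enc}(D)$, recognises exactly those of the tuples in the interpretation of $p$ at $w$. The domain $D$ may be infinite. **Theorem.** The following problem $\mathrm{EPP}_{nm,qf}$ is decidable. *Input:* an automatic epistemic model $M$ (given by automata as above), a distinguished world $w$ of $M$, an action model $E$ all of whose preconditions and postconditions are non-modal and all of whose postconditions are moreover quantifier-free, and an arbitrary first-order epistemic formula $\gamma$ (the goal). *Question:* is there a history $h$ starting from $w$ such that $ME^*,h\models\gamma$? Decidability is uniform: there is one algorithm that answers the question correctly for every input, the signature and the set of agents being also part of the input. -/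

import Mathlib

universe u v

namespace FOEpistemic

/-! ### Syntax -/

/-- A finite relational first-order signature: predicates numbered `0, …, numPred - 1`, each with
its arity. -/
structure Signature where
  numPred : ℕ
  arity : Fin numPred → ℕ

/-- First-order epistemic formulas over the signature `σ`, for the agents `0, …, n - 1`;
the variables are the natural numbers. -/
inductive Formula (σ : Signature) (n : ℕ) : Type
  | atom (p : Fin σ.numPred) (x : Fin (σ.arity p) → ℕ) : Formula σ n
  | neg (φ : Formula σ n) : Formula σ n
  | conj (φ ψ : Formula σ n) : Formula σ n
  | all (x : ℕ) (φ : Formula σ n) : Formula σ n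
  | box (a : Fin n) (φ : Formula σ n) : Formula σ n

namespace Formula

variable {σ : Signature} {n : ℕ}

/-- The free variables of a formula. -/
def freeVars : Formula σ n → Set ℕ
  | atom _ x => Set.range x
  | neg φ => φ.freeVars
  | conj φ ψ => φ.freeVars ∪ ψ.freeVars
  | all x φ => φ.freeVars \ {x}
  | box _ φ => φ.freeVars

/-- Pure first-order formulas: no epistemic modality occurs. -/
def NonModal : Formula σ n → Prop
  | atom _ _ => True
  | neg φ => φ.NonModal
  | conj φ ψ => φ.NonModal ∧ ψ.NonModal
  | all _ φ => φ.NonModal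
  | box _ _ => False

/-- No first-order quantifier occurs. -/
def QuantifierFree : Formula σ n → Prop
  | atom _ _ => True
  | neg φ => φ.QuantifierFree
  | conj φ ψ => φ.QuantifierFree ∧ ψ.QuantifierFree
  | all _ _ => False
  | box _ φ => φ.QuantifierFree

end Formula

/-! ### Epistemic models and satisfaction -/

/-- A first-order structure over the signature `σ` with domain `D`. -/
abbrev Interp (σ : Signature) (D : Type u) : Type u :=
  (p : Fin σ.numPred) → Set (Fin (σ.arity p) → D)

/-- A first-order epistemic model over the domain `D`: worlds, one accessibility relation for each
agent, and a first-order structure with domain `D` at each world. -/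
structure EpistemicModel (σ : Signature) (n : ℕ) (D : Type u) where
  World : Type v
  rel : Fin n → World → World → Prop
  interp : World → Interp σ D

/-- Satisfaction of a formula at a world under an assignment of the variables. -/
def Sat {σ : Signature} {n : ℕ} {D : Type u} (M : EpistemicModel.{u, v} σ n D) :
    M.World → (ℕ → D) → Formula σ n → Prop
  | w, val, .atom p x => (fun i => val (x i)) ∈ M.interp w p
  | w, val, .neg φ => ¬ Sat M w val φ
  | w, val, .conj φ ψ => Sat M w val φ ∧ Sat M w val ψ
  | w, val, .all x φ => ∀ d : D, Sat M w (Function.update val x d) φ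
  | w, val, .box a φ => ∀ w' : M.World, M.rel a w w' → Sat M w' val φ

/-- Truth at a world: satisfaction under every assignment. -/
def Holds {σ : Signature} {n : ℕ} {D : Type u} (M : EpistemicModel.{u, v} σ n D)
    (w : M.World) (φ : Formula σ n) : Prop :=
  ∀ val : ℕ → D, Sat M w val φ

/-! ### Action models, product update and histories -/

/-- An action model: a non-empty finite set of events (numbered from `0`), an accessibility relation
for each agent, a closed precondition for each event, and, for each event and each predicate `p` of
arity `k`, a postcondition whose free variables are among the variables `0, …, k - 1`. -/
structure ActionModel (σ : Signature) (n : ℕ) where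
  numEvents : ℕ
  numEvents_pos : 0 < numEvents
  rel : Fin n → Fin numEvents → Fin numEvents → Prop
  pre : Fin numEvents → Formula σ n
  pre_closed : ∀ e, (pre e).freeVars = ∅
  post : Fin numEvents → Fin σ.numPred → Formula σ n
  post_freeVars : ∀ e p, (post e p).freeVars ⊆ {x | x < σ.arity p}

namespace ActionModel

variable {σ : Signature} {n : ℕ}

/-- All preconditions and all postconditions are pure first-order formulas. -/
def NonModal (E : ActionModel σ n) : Prop :=
  (∀ e, (E.pre e).NonModal) ∧ ∀ e p, (E.post e p).NonModal

/-- All postconditions are quantifier-free. -/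
def QuantifierFreePost (E : ActionModel σ n) : Prop :=
  ∀ e p, (E.post e p).QuantifierFree

end ActionModel

namespace EpistemicModel

variable {σ : Signature} {n : ℕ} {D : Type u}

/-- The product update of an epistemic model with an action model. -/
def update (M : EpistemicModel.{u, v} σ n D) (E : ActionModel σ n) :
    EpistemicModel.{u, v} σ n D where
  World := {we : M.World × Fin E.numEvents // Holds M we.1 (E.pre we.2)}
  rel a h h' := M.rel a h.1.1 h'.1.1 ∧ E.rel a h.1.2 h'.1.2
  interp h p := {d | ∀ val : ℕ → D, (∀ i : Fin (σ.arity p), val i = d i) →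
    Sat M h.1.1 val (E.post h.1.2 p)}

/-- The `k`-th iterated update. -/
def iterUpdate (M : EpistemicModel.{u, v} σ n D) (E : ActionModel σ n) :
    ℕ → EpistemicModel.{u, v} σ n D
  | 0 => M
  | k + 1 => (iterUpdate M E k).update E

/-- The world from which a history (a world of an iterated update) starts. -/
def root (M : EpistemicModel.{u, v} σ n D) (E : ActionModel σ n) :
    (k : ℕ) → (M.iterUpdate E k).World → M.World
  | 0, w => w
  | k + 1, h => root M E k h.1.1

/-- The epistemic model of histories: the disjoint union of all the iterated updates. -/
def histories (M : EpistemicModel.{u, v} σ n D) (E : ActionModel σ n) :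
    EpistemicModel.{u, v} σ n D where
  World := Σ k : ℕ, (M.iterUpdate E k).World
  rel a h h' := ∃ (k : ℕ) (x y : (M.iterUpdate E k).World),
    (M.iterUpdate E k).rel a x y ∧ h = ⟨k, x⟩ ∧ h' = ⟨k, y⟩
  interp h := (M.iterUpdate E h.1).interp h.2

/-- The question asked by the epistemic planning problem: is there a history that starts from `w`
and satisfies the goal in the epistemic model of histories? -/
def HasPlan (M : EpistemicModel.{u, v} σ n D) (w : M.World) (E : ActionModel σ n)
    (goal : Formula σ n) : Prop :=
  ∃ h : (M.histories E).World, M.root E h.1 h.2 = w ∧ Holds (M.histories E) h goal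

end EpistemicModel

/-! ### Automatic presentations -/

/-- A (nondeterministic) finite automaton over the alphabet `A`, with states `0, …, numStates - 1`
and finite lists of initial states, of accepting states and of transitions. -/
structure FinAut (A : Type) where
  numStates : ℕ
  start : List (Fin numStates)
  accept : List (Fin numStates)
  trans : List (Fin numStates × A × Fin numStates)

/-- The language recognised by a finite automaton. -/
def FinAut.language {A : Type} (𝒜 : FinAut A) : Language A :=
  NFA.accepts (σ := Fin 𝒜.numStates)
    { step := fun q a => {q' | (q, a, q') ∈ 𝒜.trans}
      start := {q | q ∈ 𝒜.start}
      accept := {q | q ∈ 𝒜.accept} }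

/-- The convolution of an `r`-tuple of words: the `j`-th letter of the convolution is the tuple of
their `j`-th letters, where `none` is the padding symbol used beyond the end of a word, and the
length is the maximal length of the words. -/
def conv {A : Type} {r : ℕ} (u : Fin r → List A) : List (Fin r → Option A) :=
  (List.range (Finset.univ.sup fun i => (u i).length)).map fun j i => (u i)[j]?

/-- An automatic presentation of an epistemic model over `D`: an enumeration of its finitely many
worlds, an encoding of the common domain `D` as a regular language of words over a finite alphabet
(given by a finite automaton), and, for each world and each predicate, a finite automaton that
recognises, among the convolutions of the tuples of codes of elements of `D`, those of the tuples in
the interpretation of the predicate at that world. -/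
structure EpistemicModel.AutomaticPresentation {σ : Signature} {n : ℕ} {D : Type u}
    (M : EpistemicModel.{u, v} σ n D) where
  numWorlds : ℕ
  world : Fin numWorlds ≃ M.World
  alphabet : ℕ
  domAut : FinAut (Fin alphabet)
  predAut : Fin numWorlds → (p : Fin σ.numPred) →
    FinAut (Fin (σ.arity p) → Option (Fin alphabet))
  enc : D → List (Fin alphabet)
  enc_bijOn : Set.BijOn enc Set.univ domAut.language
  enc_interp : ∀ (i : Fin numWorlds) (p : Fin σ.numPred) (d : Fin (σ.arity p) → D),
    d ∈ M.interp (world i) p ↔ conv (fun j => enc (d j)) ∈ (predAut i p).language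

/-! ### Coding of the inputs as finite data -/

/-- A formula is coded by the list of its symbols in reverse Polish notation; each symbol is a
number saying which constructor it is, and the list of its indices. -/
abbrev FormulaCode : Type := List (ℕ × List ℕ)

/-- The code of a formula. -/
def Formula.code {σ : Signature} {n : ℕ} : Formula σ n → FormulaCode
  | .atom p x => [(0, (p : ℕ) :: List.ofFn x)]
  | .neg φ => φ.code ++ [(1, [])]
  | .conj φ ψ => φ.code ++ ψ.code ++ [(2, [])]
  | .all x φ => φ.code ++ [(3, [x])]
  | .box a φ => φ.code ++ [(4, [(a : ℕ)])]

/-- Codes of automata with letters coded in `L`: number of states, initial states, accepting states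
and transitions. -/
abbrev AutCode (L : Type) : Type := ℕ × List ℕ × List ℕ × List (ℕ × L × ℕ)

/-- The code of an automaton, relative to a coding of its letters. -/
def FinAut.code {A L : Type} (letter : A → L) (𝒜 : FinAut A) : AutCode L :=
  (𝒜.numStates, 𝒜.start.map fun q => (q : ℕ), 𝒜.accept.map fun q => (q : ℕ),
    𝒜.trans.map fun t => ((t.1 : ℕ), letter t.2.1, (t.2.2 : ℕ)))

open Classical in
/-- The table of truth values of a family of `n` binary relations on `{0, …, m - 1}`. -/
noncomputable def relCode {n m : ℕ} (R : Fin n → Fin m → Fin m → Prop) :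
    List (List (List Bool)) :=
  List.ofFn fun a => List.ofFn fun i => List.ofFn fun j => decide (R a i j)

/-- Codes of inputs, with components: the arities of the predicates; the number of agents;
the presentation of the epistemic model (size of the alphabet, accessibility relations, automaton of
the domain, automaton of each predicate at each world); the number of the distinguished world;
the action model (accessibility relations, preconditions, postconditions); the goal. -/
abbrev InputCode : Type :=
  List ℕ × ℕ ×
    (ℕ × List (List (List Bool)) × AutCode ℕ × List (List (AutCode (List (Option ℕ))))) ×
    ℕ ×
    (List (List (List Bool)) × List FormulaCode × List (List FormulaCode)) ×
    FormulaCode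

/-- The code of an input `(M, w, E, goal)` of the epistemic planning problem, where `M` is given by
an automatic presentation. -/
noncomputable def inputCode {σ : Signature} {n : ℕ} {D : Type u} (M : EpistemicModel.{u, v} σ n D)
    (P : M.AutomaticPresentation) (w : M.World) (E : ActionModel σ n) (goal : Formula σ n) :
    InputCode :=
  (List.ofFn σ.arity, n,
    (P.alphabet,
      relCode (fun a i j => M.rel a (P.world i) (P.world j)),
      P.domAut.code (fun l : Fin P.alphabet => (l : ℕ)),
      List.ofFn fun i => List.ofFn fun p => (P.predAut i p).code
        (fun l => List.ofFn fun j => (l j).map fun b => (b : ℕ))),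
    (P.world.symm w : ℕ),
    (relCode E.rel, List.ofFn fun e => (E.pre e).code,
      List.ofFn fun e => List.ofFn fun p => (E.post e p).code),
    goal.code)

end FOEpistemic

/-!
The domain of an automatic model may be infinite, but quantifiers over it can be bounded. Words over
a finite alphabet are read in parallel, as columns padded at the end, by a deterministic automaton
that runs the automata of all atoms at all worlds of the initial model (`baseStep`). Since
postconditions are quantifier-free, the atoms at every history are Boolean combinations of atoms of
the initial model, so this one automaton determines the truth of all quantifier-free formulas at all
histories, modalities included (`AtomEquiv.iterUpdate`, `Resolves.of_atomEquiv`). A subset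
construction (`liftStep`) adds one level of quantifiers (`Resolves.lift`). Pumping in the automaton
for quantifier depth `r` shows that a falsified (or satisfied) formula is falsified (or satisfied) by
values that exceed the lengths of the parameters by at most the number of states
(`Resolves.hasShortWitnesses`).

The length of histories can be bounded as well. The first-order structure at a history is a union of
classes of tuples that the base automaton does not distinguish, so there are finitely many such
structures. Hence there are finitely many classes of histories up to bisimilarity of depth `m`
(`exists_label`). Non-modal preconditions and postconditions depend only on the structure at a
history, so product updates preserve `m`-bisimilarity (`NBisim.update`), and a shortest history that
reaches a goal of modal depth `m` is no longer than the number of classes (`exists_short_canReach`).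

Both bounds are primitive recursive in the code of the input, which itself bounds all parameters of
the input. So it suffices to evaluate formulas by brute force, on tables of finite approximations of
the iterated updates (`evalCode`, `updateTable`). The resulting procedure `decidePlan` is primitive
recursive (`primrec_decidePlan`) and correct (`decidePlan_iff`).
-/

/-! ### Closure properties of primitive recursive functions -/

namespace FOEpistemic

/-- Membership in a list, as a Boolean. -/
def memB {β : Type*} [DecidableEq β] (b : β) (l : List β) : Bool := l.any fun c => b == c

@[simp] theorem memB_iff {β : Type*} [DecidableEq β] {b : β} {l : List β} : memB b l = true ↔ b ∈ l := by
  simp [memB]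

section PrimrecClosure

-- With these closure properties, `fun_prop` proves that explicitly given functions are primitive
-- recursive. Bodies of binders are uncurried: their free and bound variables form a tuple.
attribute [fun_prop] Primrec
attribute [fun_prop] Primrec.id Primrec.const Primrec.comp

variable {α β γ σ : Type*} [Primcodable α] [Primcodable β] [Primcodable γ] [Primcodable σ]

@[fun_prop] theorem primrec_fst {f : α → β × γ} (hf : Primrec f) : Primrec fun a => (f a).1 :=
  Primrec.fst.comp hf

@[fun_prop] theorem primrec_snd {f : α → β × γ} (hf : Primrec f) : Primrec fun a => (f a).2 :=
  Primrec.snd.comp hf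

@[fun_prop] theorem primrec_mk {f : α → β} {g : α → γ} (hf : Primrec f) (hg : Primrec g) :
    Primrec fun a => (f a, g a) :=
  hf.pair hg

@[fun_prop] theorem primrec_map {f : α → List β} {g : α → β → σ} (hf : Primrec f)
    (hg : Primrec fun x : α × β => g x.1 x.2) : Primrec fun a => (f a).map fun b => g a b :=
  Primrec.list_map hf hg

@[fun_prop] theorem primrec_flatMap {f : α → List β} {g : α → β → List σ} (hf : Primrec f)
    (hg : Primrec fun x : α × β => g x.1 x.2) : Primrec fun a => (f a).flatMap fun b => g a b :=
  Primrec.list_flatMap hf hg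

@[fun_prop] theorem primrec_foldl {f : α → List β} {g : α → σ} {h : α → σ → β → σ}
    (hf : Primrec f) (hg : Primrec g) (hh : Primrec fun x : α × σ × β => h x.1 x.2.1 x.2.2) :
    Primrec fun a => (f a).foldl (fun s b => h a s b) (g a) :=
  Primrec.list_foldl hf hg hh.to₂

@[fun_prop] theorem primrec_natRec {f : α → ℕ} {g : α → σ} {h : α → ℕ → σ → σ}
    (hf : Primrec f) (hg : Primrec g) (hh : Primrec fun x : α × ℕ × σ => h x.1 x.2.1 x.2.2) :
    Primrec fun a => Nat.rec (motive := fun _ => σ) (g a) (fun k s => h a k s) (f a) :=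
  Primrec.nat_rec' hf hg hh.to₂

@[fun_prop] theorem primrec_cons {f : α → β} {g : α → List β} (hf : Primrec f) (hg : Primrec g) :
    Primrec fun a => f a :: g a :=
  Primrec.list_cons.comp hf hg

@[fun_prop] theorem primrec_headI [Inhabited β] {f : α → List β} (hf : Primrec f) :
    Primrec fun a => (f a).headI :=
  Primrec.list_headI.comp hf

@[fun_prop] theorem primrec_tail {f : α → List β} (hf : Primrec f) :
    Primrec fun a => (f a).tail :=
  Primrec.list_tail.comp hf

@[fun_prop] theorem primrec_length {f : α → List β} (hf : Primrec f) :
    Primrec fun a => (f a).length :=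
  Primrec.list_length.comp hf

@[fun_prop] theorem primrec_range {f : α → ℕ} (hf : Primrec f) :
    Primrec fun a => List.range (f a) :=
  Primrec.list_range.comp hf

@[fun_prop] theorem primrec_take {f : α → ℕ} {g : α → List β} (hf : Primrec f) (hg : Primrec g) :
    Primrec fun a => (g a).take (f a) :=
  Primrec.list_take.comp hf hg

@[fun_prop] theorem primrec_drop {f : α → ℕ} {g : α → List β} (hf : Primrec f) (hg : Primrec g) :
    Primrec fun a => (g a).drop (f a) :=
  Primrec.list_drop.comp hf hg

@[fun_prop] theorem primrec_getD {d : β} {f : α → List β} {g : α → ℕ} (hf : Primrec f)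
    (hg : Primrec g) : Primrec fun a => (f a).getD (g a) d :=
  (Primrec.list_getD d).comp hf hg

@[fun_prop] theorem primrec_getElem? {f : α → List β} {g : α → ℕ} (hf : Primrec f)
    (hg : Primrec g) : Primrec fun a => (f a)[g a]? :=
  Primrec.list_getElem?.comp hf hg

@[fun_prop] theorem primrec_set {f : α → List β} {g : α → ℕ} {h : α → β} (hf : Primrec f)
    (hg : Primrec g) (hh : Primrec h) : Primrec fun a => (f a).set (g a) (h a) :=
  Primrec.list_set.comp hf (hg.pair hh)

@[fun_prop] theorem primrec_add {f g : α → ℕ} (hf : Primrec f) (hg : Primrec g) :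
    Primrec fun a => f a + g a :=
  Primrec.nat_add.comp hf hg

@[fun_prop] theorem primrec_sub {f g : α → ℕ} (hf : Primrec f) (hg : Primrec g) :
    Primrec fun a => f a - g a :=
  Primrec.nat_sub.comp hf hg

@[fun_prop] theorem primrec_mul {f g : α → ℕ} (hf : Primrec f) (hg : Primrec g) :
    Primrec fun a => f a * g a :=
  Primrec.nat_mul.comp hf hg

@[fun_prop] theorem primrec_max {f g : α → ℕ} (hf : Primrec f) (hg : Primrec g) :
    Primrec fun a => max (f a) (g a) :=
  Primrec.nat_max.comp hf hg

@[fun_prop] theorem primrec_pow {f g : α → ℕ} (hf : Primrec f) (hg : Primrec g) :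
    Primrec fun a => f a ^ g a :=
  (Primrec₂.unpaired'.1 Nat.Primrec.pow).comp hf hg

@[fun_prop] theorem primrec_cond {c : α → Bool} {f g : α → σ} (hc : Primrec c) (hf : Primrec f)
    (hg : Primrec g) : Primrec fun a => bif c a then f a else g a :=
  Primrec.cond hc hf hg

@[fun_prop] theorem primrec_not {f : α → Bool} (hf : Primrec f) : Primrec fun a => !f a :=
  Primrec.not.comp hf

@[fun_prop] theorem primrec_and {f g : α → Bool} (hf : Primrec f) (hg : Primrec g) :
    Primrec fun a => f a && g a :=
  Primrec.and.comp hf hg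

@[fun_prop] theorem primrec_or {f g : α → Bool} (hf : Primrec f) (hg : Primrec g) :
    Primrec fun a => f a || g a :=
  Primrec.or.comp hf hg

@[fun_prop] theorem primrec_beq [BEq β] [LawfulBEq β] {f g : α → β} (hf : Primrec f)
    (hg : Primrec g) : Primrec fun a => f a == g a := by
  classical
  refine ((Primrec.eq (α := β)).decide.comp hf hg).of_eq fun a => ?_
  rw [Bool.eq_iff_iff, decide_eq_true_iff, beq_iff_eq]

@[fun_prop] theorem primrec_encode {f : α → β} (hf : Primrec f) :
    Primrec fun a => Encodable.encode (f a) :=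
  Primrec.encode.comp hf

@[fun_prop] theorem primrec_filter {f : α → List β} {p : α → β → Bool} (hf : Primrec f)
    (hp : Primrec fun x : α × β => p x.1 x.2) : Primrec fun a => (f a).filter fun b => p a b := by
  have h : ∀ (l : List β) (q : β → Bool),
      l.filter q = l.flatMap fun b => bif q b then [b] else [] := by
    intro l q
    induction l with
    | nil => rfl
    | cons b l ih => cases hq : q b <;> simp [hq, ih]
  simp only [h]
  fun_prop

@[fun_prop] theorem primrec_any {f : α → List β} {p : α → β → Bool} (hf : Primrec f)
    (hp : Primrec fun x : α × β => p x.1 x.2) : Primrec fun a => (f a).any fun b => p a b := by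
  have h : ∀ (l : List β) (q : β → Bool) (c : Bool),
      (c || l.any q) = l.foldl (fun s b => s || q b) c := by
    intro l q
    induction l with
    | nil => simp
    | cons b l ih => intro c; simp [← ih, Bool.or_assoc]
  have h' := fun (l : List β) (q : β → Bool) => h l q false
  simp only [Bool.false_or] at h'
  simp only [h']
  fun_prop

@[fun_prop] theorem primrec_all {f : α → List β} {p : α → β → Bool} (hf : Primrec f)
    (hp : Primrec fun x : α × β => p x.1 x.2) : Primrec fun a => (f a).all fun b => p a b := by
  simp only [List.all_eq_not_any_not]
  fun_prop

@[fun_prop] theorem primrec_memB [DecidableEq β] {f : α → β} {g : α → List β} (hf : Primrec f)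
    (hg : Primrec g) : Primrec fun a => memB (f a) (g a) := by
  unfold memB
  fun_prop

end PrimrecClosure

/-! ### The decision procedure -/

section Algorithm

/-- All words of length `k` over the list of letters `l`. -/
def tuples {β : Type*} (l : List β) (k : ℕ) : List (List β) :=
  Nat.rec [[]] (fun _ r => l.flatMap fun b => r.map fun w => b :: w) k

/-- The cartesian product of two lists. -/
def pairs {β γ : Type*} (l : List β) (l' : List γ) : List (β × γ) :=
  l.flatMap fun b => l'.map fun c => (b, c)

/-- All words of length at most `k` over the alphabet `{0, …, a - 1}`. -/
def wordsLE (a k : ℕ) : List (List ℕ) :=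
  (List.range (k + 1)).flatMap fun j => tuples (List.range a) j

/-- One step of the simulation by sets of states, on coded automata. -/
def AutCode.step {L : Type} [DecidableEq L] (𝒜 : AutCode L) (S : List ℕ) (a : L) : List ℕ :=
  (𝒜.2.2.2.filter fun t => memB t.1 S && t.2.1 == a).map fun t => t.2.2

/-- Does the coded automaton accept the word? -/
def AutCode.accepts {L : Type} [DecidableEq L] (𝒜 : AutCode L) (w : List L) : Bool :=
  (w.foldl (fun S a => AutCode.step 𝒜 S a) 𝒜.2.1).any fun q => memB q 𝒜.2.2.1

/-- The convolution of a list of words, letters being coded by lists. -/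
def convCode (ws : List (List ℕ)) : List (List (Option ℕ)) :=
  (List.range (ws.foldl (fun m w => max m w.length) 0)).map fun j => ws.map fun w => w[j]?

/-- Look up an entry in the table of a family of relations. -/
def relLookup (R : List (List (List Bool))) (a i j : ℕ) : Bool :=
  ((R.getD a []).getD i []).getD j false

namespace InputCode

/-- The arities of the predicates. -/
def arities (c : InputCode) : List ℕ := c.1

/-- The number of agents. -/
def agents (c : InputCode) : ℕ := c.2.1

/-- The size of the alphabet of the presentation. -/
def alphabet (c : InputCode) : ℕ := c.2.2.1.1

/-- The accessibility relations of the presented model. -/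
def worldRel (c : InputCode) : List (List (List Bool)) := c.2.2.1.2.1

/-- The automaton that recognises the codes of the elements of the domain. -/
def domAut (c : InputCode) : AutCode ℕ := c.2.2.1.2.2.1

/-- The automata of the predicates, at each world. -/
def predAuts (c : InputCode) : List (List (AutCode (List (Option ℕ)))) := c.2.2.1.2.2.2

/-- The number of the distinguished world. -/
def start (c : InputCode) : ℕ := c.2.2.2.1

/-- The accessibility relations of the action model. -/
def eventRel (c : InputCode) : List (List (List Bool)) := c.2.2.2.2.1.1

/-- The preconditions of the events. -/
def pres (c : InputCode) : List FormulaCode := c.2.2.2.2.1.2.1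

/-- The postconditions of the events. -/
def posts (c : InputCode) : List (List FormulaCode) := c.2.2.2.2.1.2.2

/-- The goal. -/
def goal (c : InputCode) : FormulaCode := c.2.2.2.2.2

/-- The codes of length at most `ℓ` of elements of the domain. -/
def domWords (c : InputCode) (ℓ : ℕ) : List (List ℕ) :=
  (wordsLE c.alphabet ℓ).filter fun w => AutCode.accepts c.domAut w

end InputCode

/-- A finite approximation of an epistemic model: the names of its worlds, the triples
`(a, w, w')` with `w` related to `w'` for the agent `a`, and the true atoms `(w, p, d)`, where `d` is
a tuple of codes of elements of the domain (up to some length). -/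
abbrev TableModel : Type :=
  List (List ℕ) × List (ℕ × List ℕ × List ℕ) × List (List ℕ × ℕ × List (List ℕ))

/-- A finite approximation of the extension of a formula: pairs `(w, ν)` of the name of a world and
an assignment of words to the first few variables. -/
abbrev Table : Type := List (List ℕ × List (List ℕ))

/-- Does the formula with last symbol `s`, applied to the subformulas whose extensions are on top of
the stack `st`, hold at `x.1` under the assignment `x.2`? Quantifiers range over words of length
at most `k`. -/
def evalSymbol (c : InputCode) (m : TableModel) (k : ℕ) (st : List Table) (s : ℕ × List ℕ)
    (x : List ℕ × List (List ℕ)) : Bool :=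
  bif s.1 == 0 then memB (x.1, s.2.headI, s.2.tail.map fun i => x.2.getD i []) m.2.2
  else bif s.1 == 1 then !memB x st.headI
  else bif s.1 == 2 then memB x st.tail.headI && memB x st.headI
  else bif s.1 == 3 then
    (c.domWords k).all fun d => memB (x.1, x.2.set s.2.headI d) st.headI
  else m.1.all fun w => !memB (s.2.headI, x.1, w) m.2.1 || memB (w, x.2) st.headI

/-- The effect of one symbol on the state of the evaluator: a counter, which decreases, and a stack
of extensions. When the counter is `t`, the assignments considered have values of length at most
`base + t * step`: the extension of a formula is computed on a smaller range than those of its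
subformulas, which leaves room for the witnesses of quantifiers. -/
def evalStep (c : InputCode) (V : ℕ) (m : TableModel) (base step : ℕ) (st : ℕ × List Table)
    (s : ℕ × List ℕ) : ℕ × List Table :=
  (st.1 - 1,
    ((pairs m.1 (tuples (c.domWords (base + (st.1 - 1) * step)) V)).filter fun x =>
      evalSymbol c m (base + st.1 * step) st.2 s x) ::
    st.2.drop (bif s.1 == 0 then 0 else bif s.1 == 2 then 2 else 1))

/-- The extension of a coded formula in a table model, on the assignments of words of length at most
`base` to the variables below `V`. -/
def evalCode (c : InputCode) (V : ℕ) (m : TableModel) (base step : ℕ) (φ : FormulaCode) : Table :=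
  (φ.foldl (fun st s => evalStep c V m base step st s) (φ.length, [])).2.headI

/-- Is the coded formula true at `w` under all assignments of words of length at most `N`? -/
def holdsCode (c : InputCode) (V : ℕ) (m : TableModel) (N : ℕ) (φ : FormulaCode) (w : List ℕ) :
    Bool :=
  (tuples (c.domWords N) V).all fun v => memB (w, v) (evalCode c V m N N φ)

/-- The approximation, up to length `L`, of the presented model. The world `i` has the name `[i]`. -/
def baseTable (c : InputCode) (L : ℕ) : TableModel :=
  let W := (List.range c.predAuts.length).map fun i => [i]
  (W,
    (pairs (List.range c.agents) (pairs W W)).filter fun x =>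
      relLookup c.worldRel x.1 x.2.1.headI x.2.2.headI,
    W.flatMap fun w => (List.range c.arities.length).flatMap fun p =>
      ((tuples (c.domWords L) (c.arities.getD p 0)).filter fun d =>
        AutCode.accepts ((c.predAuts.getD w.headI []).getD p (0, [], [], [])) (convCode d)).map
      fun d => (w, p, d))

/-- The names of the worlds of the product update of an approximation. The history `(w, e)` has the
name `e :: w`. -/
def updateWorlds (c : InputCode) (V N : ℕ) (m : TableModel) : List (List ℕ) :=
  (pairs (List.range c.pres.length) m.1).flatMap fun x =>
    bif holdsCode c V m N (c.pres.getD x.1 []) x.2 then [x.1 :: x.2] else []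

/-- The product update of an approximation. -/
def updateTable (c : InputCode) (V N L : ℕ) (m : TableModel) : TableModel :=
  (updateWorlds c V N m,
    (pairs (List.range c.agents) (pairs (updateWorlds c V N m) (updateWorlds c V N m))).filter
      fun x => memB (x.1, x.2.1.tail, x.2.2.tail) m.2.1 &&
        relLookup c.eventRel x.1 x.2.1.headI x.2.2.headI,
    (updateWorlds c V N m).flatMap fun w => (List.range c.arities.length).flatMap fun p =>
      ((evalCode c V m L 0 ((c.posts.getD w.headI []).getD p [])).filter fun x =>
        x.1 == w.tail).map fun x => (w, p, x.2.take (c.arities.getD p 0)))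

/-- The `k`-fold update of the approximation of the presented model. -/
def iterTable (c : InputCode) (V N L k : ℕ) : TableModel :=
  Nat.rec (baseTable c L) (fun _ m => updateTable c V N L m) k

/-- Search for a history of length at most `B` that starts from the distinguished world and
satisfies the goal. -/
def search (c : InputCode) (V N L B : ℕ) : Bool :=
  (List.range (B + 1)).any fun k => (iterTable c V N L k).1.any fun w =>
    w.getD k 0 == c.start && holdsCode c V (iterTable c V N L k) N c.goal w

/-- A bound on the number of states of an automaton that reads `V` words in parallel and runs all
automata of a presentation, the size of which is at most `Z`, on all tuples of them. -/
def baseBound (Z V : ℕ) : ℕ := ((((2 ^ Z) ^ V ^ Z) ^ Z) ^ Z) * (2 ^ Z) ^ V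

/-- A bound on the number of states after `r` applications of the construction for quantifiers. -/
def stateBound (Z V r : ℕ) : ℕ :=
  Nat.rec (baseBound Z V) (fun _ s => s * (2 ^ s * 2 ^ s) ^ V) r

/-- A bound on the number of classes of histories that formulas of modal depth at most `k`
distinguish. -/
def labelBound (Z V k : ℕ) : ℕ :=
  Nat.rec ((2 ^ baseBound Z V) ^ Z) (fun _ s => s * (2 ^ s) ^ Z) k

/-- The decision procedure. The code `Z` of the input bounds all its parameters. Atoms are tabulated
up to length `N + Z * N`, where `N` is the amount by which witnesses of quantifiers can exceed the
parameters, because a formula of the input has at most `Z` symbols. -/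
def decidePlan (c : InputCode) : Bool :=
  let Z := Encodable.encode c
  let N := stateBound Z (Z + 1) Z
  search c (Z + 1) N (N + Z * N) (labelBound Z (Z + 1) Z)

end Algorithm

/-! ### The decision procedure is primitive recursive -/

section Primrec

variable {α β γ : Type*} [Primcodable α] [Primcodable β] [Primcodable γ]

@[fun_prop] theorem primrec_tuples {f : α → List β} {g : α → ℕ} (hf : Primrec f)
    (hg : Primrec g) : Primrec fun a => tuples (f a) (g a) := by
  unfold tuples
  fun_prop

@[fun_prop] theorem primrec_pairs {f : α → List β} {g : α → List γ} (hf : Primrec f)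
    (hg : Primrec g) : Primrec fun a => pairs (f a) (g a) := by
  unfold pairs
  fun_prop

@[fun_prop] theorem primrec_accepts {L : Type} [Primcodable L] [DecidableEq L] {f : α → AutCode L}
    {g : α → List L} (hf : Primrec f) (hg : Primrec g) :
    Primrec fun a => AutCode.accepts (f a) (g a) := by
  unfold AutCode.accepts AutCode.step
  fun_prop

@[fun_prop] theorem primrec_convCode : Primrec convCode := by
  unfold convCode
  fun_prop

@[fun_prop] theorem primrec_relLookup {f : α → List (List (List Bool))} {g h k : α → ℕ}
    (hf : Primrec f) (hg : Primrec g) (hh : Primrec h) (hk : Primrec k) :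
    Primrec fun a => relLookup (f a) (g a) (h a) (k a) := by
  unfold relLookup
  fun_prop

@[fun_prop] theorem primrec_arities : Primrec InputCode.arities := by
  unfold InputCode.arities; fun_prop

@[fun_prop] theorem primrec_agents : Primrec InputCode.agents := by
  unfold InputCode.agents; fun_prop

@[fun_prop] theorem primrec_alphabet : Primrec InputCode.alphabet := by
  unfold InputCode.alphabet; fun_prop

@[fun_prop] theorem primrec_worldRel : Primrec InputCode.worldRel := by
  unfold InputCode.worldRel; fun_prop

@[fun_prop] theorem primrec_domAut : Primrec InputCode.domAut := by
  unfold InputCode.domAut; fun_prop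

@[fun_prop] theorem primrec_predAuts : Primrec InputCode.predAuts := by
  unfold InputCode.predAuts; fun_prop

@[fun_prop] theorem primrec_start : Primrec InputCode.start := by
  unfold InputCode.start; fun_prop

@[fun_prop] theorem primrec_eventRel : Primrec InputCode.eventRel := by
  unfold InputCode.eventRel; fun_prop

@[fun_prop] theorem primrec_pres : Primrec InputCode.pres := by
  unfold InputCode.pres; fun_prop

@[fun_prop] theorem primrec_posts : Primrec InputCode.posts := by
  unfold InputCode.posts; fun_prop

@[fun_prop] theorem primrec_goal : Primrec InputCode.goal := by
  unfold InputCode.goal; fun_prop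

@[fun_prop] theorem primrec_domWords {f : α → InputCode} {g : α → ℕ} (hf : Primrec f)
    (hg : Primrec g) : Primrec fun a => (f a).domWords (g a) := by
  unfold InputCode.domWords wordsLE
  fun_prop

@[fun_prop] theorem primrec_evalSymbol {c : α → InputCode} {m : α → TableModel} {k : α → ℕ}
    {st : α → List Table} {s : α → ℕ × List ℕ} {x : α → List ℕ × List (List ℕ)} (hc : Primrec c)
    (hm : Primrec m) (hk : Primrec k) (hst : Primrec st) (hs : Primrec s) (hx : Primrec x) :
    Primrec fun a => evalSymbol (c a) (m a) (k a) (st a) (s a) (x a) := by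
  unfold evalSymbol
  fun_prop

@[fun_prop] theorem primrec_evalStep {c : α → InputCode} {V : α → ℕ} {m : α → TableModel}
    {b k : α → ℕ} {st : α → ℕ × List Table} {s : α → ℕ × List ℕ} (hc : Primrec c) (hV : Primrec V)
    (hm : Primrec m) (hb : Primrec b) (hk : Primrec k) (hst : Primrec st) (hs : Primrec s) :
    Primrec fun a => evalStep (c a) (V a) (m a) (b a) (k a) (st a) (s a) := by
  unfold evalStep
  fun_prop

@[fun_prop] theorem primrec_evalCode {c : α → InputCode} {V : α → ℕ} {m : α → TableModel}
    {b k : α → ℕ} {φ : α → FormulaCode} (hc : Primrec c) (hV : Primrec V)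
    (hm : Primrec m) (hb : Primrec b) (hk : Primrec k) (hφ : Primrec φ) :
    Primrec fun a => evalCode (c a) (V a) (m a) (b a) (k a) (φ a) := by
  unfold evalCode
  fun_prop

@[fun_prop] theorem primrec_holdsCode {c : α → InputCode} {V : α → ℕ} {m : α → TableModel}
    {N : α → ℕ} {φ : α → FormulaCode} {w : α → List ℕ} (hc : Primrec c) (hV : Primrec V)
    (hm : Primrec m) (hN : Primrec N) (hφ : Primrec φ) (hw : Primrec w) :
    Primrec fun a => holdsCode (c a) (V a) (m a) (N a) (φ a) (w a) := by
  unfold holdsCode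
  fun_prop

@[fun_prop] theorem primrec_baseTable {c : α → InputCode} {L : α → ℕ} (hc : Primrec c)
    (hL : Primrec L) : Primrec fun a => baseTable (c a) (L a) := by
  unfold baseTable
  fun_prop

@[fun_prop] theorem primrec_updateWorlds {c : α → InputCode} {V N : α → ℕ} {m : α → TableModel}
    (hc : Primrec c) (hV : Primrec V) (hN : Primrec N) (hm : Primrec m) :
    Primrec fun a => updateWorlds (c a) (V a) (N a) (m a) := by
  unfold updateWorlds
  fun_prop

@[fun_prop] theorem primrec_updateTable {c : α → InputCode} {V N L : α → ℕ} {m : α → TableModel}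
    (hc : Primrec c) (hV : Primrec V) (hN : Primrec N) (hL : Primrec L) (hm : Primrec m) :
    Primrec fun a => updateTable (c a) (V a) (N a) (L a) (m a) := by
  unfold updateTable
  fun_prop

@[fun_prop] theorem primrec_search {c : α → InputCode} {V N L B : α → ℕ} (hc : Primrec c)
    (hV : Primrec V) (hN : Primrec N) (hL : Primrec L) (hB : Primrec B) :
    Primrec fun a => search (c a) (V a) (N a) (L a) (B a) := by
  unfold search iterTable
  fun_prop

theorem primrec_decidePlan : Primrec decidePlan := by
  unfold decidePlan stateBound labelBound baseBound
  fun_prop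

end Primrec

/-! ### Syntactic measures and elementary semantics -/

namespace Formula

variable {σ : Signature} {n : ℕ}

/-- All variables of the formula, free or bound, are below `V`. -/
def VarsLT (V : ℕ) : Formula σ n → Prop
  | atom _ x => ∀ i, x i < V
  | neg φ => φ.VarsLT V
  | conj φ ψ => φ.VarsLT V ∧ ψ.VarsLT V
  | all x φ => x < V ∧ φ.VarsLT V
  | box _ φ => φ.VarsLT V

/-- The nesting depth of first-order quantifiers. -/
def quantDepth : Formula σ n → ℕ
  | atom _ _ => 0
  | neg φ => φ.quantDepth
  | conj φ ψ => max φ.quantDepth ψ.quantDepth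
  | all _ φ => φ.quantDepth + 1
  | box _ φ => φ.quantDepth

/-- The nesting depth of modalities. -/
def modalDepth : Formula σ n → ℕ
  | atom _ _ => 0
  | neg φ => φ.modalDepth
  | conj φ ψ => max φ.modalDepth ψ.modalDepth
  | all _ φ => φ.modalDepth
  | box _ φ => φ.modalDepth + 1

end Formula

section Semantics

variable {σ : Signature} {n : ℕ} {D : Type u}

theorem sat_congr_freeVars {M : EpistemicModel.{u, v} σ n D} (φ : Formula σ n) :
    ∀ (w : M.World) (ν ν' : ℕ → D), (∀ y ∈ φ.freeVars, ν y = ν' y) →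
      (Sat M w ν φ ↔ Sat M w ν' φ) := by
  induction φ with
  | atom p x =>
    intro w ν ν' h
    have : (fun i => ν (x i)) = fun i => ν' (x i) := funext fun i => h _ ⟨i, rfl⟩
    simp only [Sat, this]
  | neg φ ih => intro w ν ν' h; exact not_congr (ih w ν ν' h)
  | conj φ ψ ih₁ ih₂ =>
    intro w ν ν' h
    exact and_congr (ih₁ w ν ν' fun y hy => h y (Or.inl hy))
      (ih₂ w ν ν' fun y hy => h y (Or.inr hy))
  | all x φ ih =>
    intro w ν ν' h
    refine forall_congr' fun d => ih w _ _ fun y hy => ?_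
    by_cases hyx : y = x
    · subst hyx; simp
    · simp [hyx, h y ⟨hy, hyx⟩]
  | box a φ ih =>
    intro w ν ν' h
    exact forall_congr' fun w' => imp_congr_right fun _ => ih w' ν ν' h

/-- If two assignments agree on the atoms at a world, they agree there on all quantifier-free
non-modal formulas. -/
theorem sat_congr_atoms {M : EpistemicModel.{u, v} σ n D} {w : M.World} {V : ℕ} {ν ν' : ℕ → D}
    (h : ∀ p (x : Fin (σ.arity p) → ℕ), (∀ i, x i < V) →
      ((fun i => ν (x i)) ∈ M.interp w p ↔ (fun i => ν' (x i)) ∈ M.interp w p)) :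
    ∀ φ : Formula σ n, φ.NonModal → φ.QuantifierFree → φ.VarsLT V →
      (Sat M w ν φ ↔ Sat M w ν' φ)
  | .atom p x, _, _, hV => h p x hV
  | .neg φ, h₁, h₂, hV => not_congr (sat_congr_atoms h φ h₁ h₂ hV)
  | .conj φ ψ, h₁, h₂, hV => and_congr (sat_congr_atoms h φ h₁.1 h₂.1 hV.1)
      (sat_congr_atoms h ψ h₁.2 h₂.2 hV.2)
  | .all _ _, _, h₂, _ => h₂.elim
  | .box _ _, h₁, _, _ => h₁.elim

theorem mem_update_interp {M : EpistemicModel.{u, v} σ n D} {E : ActionModel σ n}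
    {h : (M.update E).World} {p : Fin σ.numPred} {d : Fin (σ.arity p) → D} {val : ℕ → D}
    (hv : ∀ i : Fin (σ.arity p), val i = d i) :
    d ∈ (M.update E).interp h p ↔ Sat M h.1.1 val (E.post h.1.2 p) := by
  refine ⟨fun H => H val hv, fun H val' hv' => ?_⟩
  refine (sat_congr_freeVars _ _ _ _ fun y hy => ?_).1 H
  have hy' := E.post_freeVars _ _ hy
  exact (hv ⟨y, hy'⟩).trans (hv' ⟨y, hy'⟩).symm

theorem sat_histories_iff {M : EpistemicModel.{u, v} σ n D} {E : ActionModel σ n}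
    (φ : Formula σ n) : ∀ (k : ℕ) (h : (M.iterUpdate E k).World) (ν : ℕ → D),
      (Sat (M.histories E) ⟨k, h⟩ ν φ ↔ Sat (M.iterUpdate E k) h ν φ) := by
  induction φ with
  | atom p x => intro k h ν; exact Iff.rfl
  | neg φ ih => intro k h ν; exact not_congr (ih k h ν)
  | conj φ ψ ih₁ ih₂ => intro k h ν; exact and_congr (ih₁ k h ν) (ih₂ k h ν)
  | all x φ ih => intro k h ν; exact forall_congr' fun d => ih k h _
  | box a φ ih =>
    intro k h ν
    constructor
    · intro H h' hr
      exact (ih k h' ν).1 (H ⟨k, h'⟩ ⟨k, h, h', hr, rfl, rfl⟩)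
    · rintro H _ ⟨k', x, y, hr, hx, rfl⟩
      obtain ⟨rfl, hx⟩ := Sigma.mk.inj_iff.1 hx
      obtain rfl := eq_of_heq hx
      exact (ih k y ν).2 (H y hr)

/-- The assignments `ν` and `ν'` satisfy the same atoms with variables below `V`, at all worlds. -/
def AtomEquiv (M : EpistemicModel.{u, v} σ n D) (V : ℕ) (ν ν' : ℕ → D) : Prop :=
  ∀ (w : M.World) (p : Fin σ.numPred) (x : Fin (σ.arity p) → ℕ), (∀ i, x i < V) →
    ((fun i => ν (x i)) ∈ M.interp w p ↔ (fun i => ν' (x i)) ∈ M.interp w p)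

theorem AtomEquiv.comp {M : EpistemicModel.{u, v} σ n D} {V : ℕ} {ν ν' : ℕ → D}
    (h : AtomEquiv M V ν ν') {y : ℕ → ℕ} (hy : ∀ i, y i < V) :
    AtomEquiv M V (fun i => ν (y i)) fun i => ν' (y i) :=
  fun w p x _ => h w p (fun i => y (x i)) fun _ => hy _

/-- Quantifier-free postconditions preserve the equivalence of assignments: assignments that agree
on the atoms of the initial model agree on the atoms of all iterated updates. -/
theorem AtomEquiv.iterUpdate {M : EpistemicModel.{u, v} σ n D} {E : ActionModel σ n} {V : ℕ}
    (hV : 0 < V) (hE : E.NonModal) (hE' : E.QuantifierFreePost)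
    (hp : ∀ e p, (E.post e p).VarsLT V) :
    ∀ (k : ℕ) {ν ν' : ℕ → D}, AtomEquiv M V ν ν' → AtomEquiv (M.iterUpdate E k) V ν ν'
  | 0, _, _, h => h
  | k + 1, ν, ν', h => by
    intro w p x hx
    let y : ℕ → ℕ := fun i => if hi : i < σ.arity p then x ⟨i, hi⟩ else 0
    have hy : ∀ i, y i < V := by
      intro i
      by_cases hi : i < σ.arity p
      · simp only [y, hi, dite_true]; exact hx _
      · simpa only [y, hi, dite_false] using hV
    have hyx : ∀ i : Fin (σ.arity p), y i = x i := by
      intro i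
      simp [y]
    refine (mem_update_interp (M := M.iterUpdate E k) (val := fun i => ν (y i))
      fun i => by simp only [hyx]).trans (Iff.trans ?_
      (mem_update_interp (M := M.iterUpdate E k) (val := fun i => ν' (y i))
        fun i => by simp only [hyx]).symm)
    have := (AtomEquiv.iterUpdate (E := E) hV hE hE' hp k h).comp hy w.1.1
    exact sat_congr_atoms this _ (hE.2 _ _) (hE' _ _) (hp _ _)

end Semantics

/-! ### Bounded bisimulations -/

section Bisimulation

variable {σ : Signature} {n : ℕ} {D : Type u}

/-- Bisimilarity up to `m` steps between worlds of two models over the same domain; bisimilar worlds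
carry the same first-order structure. -/
def NBisim : ℕ → (M M' : EpistemicModel.{u, v} σ n D) → M.World → M'.World → Prop
  | 0, M, M', w, w' => M.interp w = M'.interp w'
  | m + 1, M, M', w, w' => M.interp w = M'.interp w' ∧
      (∀ a g, M.rel a w g → ∃ g', M'.rel a w' g' ∧ NBisim m M M' g g') ∧
      ∀ a g', M'.rel a w' g' → ∃ g, M.rel a w g ∧ NBisim m M M' g g'

theorem NBisim.interp_eq {m : ℕ} {M M' : EpistemicModel.{u, v} σ n D} {w : M.World}
    {w' : M'.World} (h : NBisim m M M' w w') : M.interp w = M'.interp w' := by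
  cases m with
  | zero => exact h
  | succ m => exact h.1

theorem NBisim.sat_iff {M M' : EpistemicModel.{u, v} σ n D} (φ : Formula σ n) :
    ∀ {m : ℕ} {w : M.World} {w' : M'.World}, NBisim m M M' w w' → φ.modalDepth ≤ m →
      ∀ ν : ℕ → D, Sat M w ν φ ↔ Sat M' w' ν φ := by
  induction φ with
  | atom p x =>
    intro m w w' h _ ν
    simp only [Sat, h.interp_eq]
  | neg φ ih => intro m w w' h hm ν; exact not_congr (ih h hm ν)
  | conj φ ψ ih₁ ih₂ =>
    intro m w w' h hm ν
    exact and_congr (ih₁ h ((le_max_left _ _).trans hm) ν) (ih₂ h ((le_max_right _ _).trans hm) ν)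
  | all x φ ih => intro m w w' h hm ν; exact forall_congr' fun d => ih h hm _
  | box a φ ih =>
    intro m w w' h hm ν
    obtain ⟨m, rfl⟩ : ∃ m', m = m' + 1 := ⟨m - 1, by simp only [Formula.modalDepth] at hm; omega⟩
    have hm' : φ.modalDepth ≤ m := Nat.le_of_succ_le_succ hm
    constructor
    · intro H g' hg'
      obtain ⟨g, hg, hb⟩ := h.2.2 a g' hg'
      exact (ih hb hm' ν).1 (H g hg)
    · intro H g hg
      obtain ⟨g', hg', hb⟩ := h.2.1 a g hg
      exact (ih hb hm' ν).2 (H g' hg')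

theorem NBisim.holds_iff {M M' : EpistemicModel.{u, v} σ n D} {φ : Formula σ n} {m : ℕ}
    {w : M.World} {w' : M'.World} (h : NBisim m M M' w w') (hm : φ.modalDepth ≤ m) :
    Holds M w φ ↔ Holds M' w' φ :=
  forall_congr' fun ν => h.sat_iff φ hm ν

theorem Formula.NonModal.modalDepth_eq : ∀ {φ : Formula σ n}, φ.NonModal → φ.modalDepth = 0
  | .atom _ _, _ => rfl
  | .neg φ, h => Formula.NonModal.modalDepth_eq (φ := φ) h
  | .conj φ ψ, h => by
    simp [Formula.modalDepth, Formula.NonModal.modalDepth_eq (φ := φ) h.1,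
      Formula.NonModal.modalDepth_eq (φ := ψ) h.2]
  | .all _ φ, h => Formula.NonModal.modalDepth_eq (φ := φ) h
  | .box _ _, h => h.elim

/-- A non-modal action changes the first-order structure of a world in a way that depends only on
that structure, so that it preserves bounded bisimilarity. -/
theorem NBisim.update {E : ActionModel σ n} (hE : E.NonModal) {M M' : EpistemicModel.{u, v} σ n D}
    {e : Fin E.numEvents} : ∀ {m : ℕ} {w : M.World} {w' : M'.World}
      (hw : Holds M w (E.pre e)) (hw' : Holds M' w' (E.pre e)), NBisim m M M' w w' →
      NBisim m (M.update E) (M'.update E) ⟨(w, e), hw⟩ ⟨(w', e), hw'⟩ := by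
  have hint : ∀ {m : ℕ} {e : Fin E.numEvents} {w : M.World} {w' : M'.World}
      (hw : Holds M w (E.pre e)) (hw' : Holds M' w' (E.pre e)), NBisim m M M' w w' →
      (M.update E).interp ⟨(w, e), hw⟩ = (M'.update E).interp ⟨(w', e), hw'⟩ := by
    intro m e w w' hw hw' h
    funext p
    ext d
    refine forall_congr' fun ν => imp_congr_right fun _ => h.sat_iff _ ?_ ν
    rw [(hE.2 e p).modalDepth_eq]
    exact Nat.zero_le _
  intro m
  induction m generalizing e with
  | zero => intro w w' hw hw' h; exact hint hw hw' h
  | succ m ih =>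
    intro w w' hw hw' h
    have hpre : ∀ {e : Fin E.numEvents} {w : M.World} {w' : M'.World}, NBisim m M M' w w' →
        (Holds M w (E.pre e) ↔ Holds M' w' (E.pre e)) := by
      intro e w w' h
      refine h.holds_iff ?_
      rw [(hE.1 e).modalDepth_eq]
      exact Nat.zero_le _
    refine ⟨hint hw hw' h, ?_, ?_⟩
    · rintro a ⟨⟨g, e'⟩, hg⟩ ⟨hr, hre⟩
      obtain ⟨g', hr', hb⟩ := h.2.1 a g hr
      exact ⟨⟨(g', e'), (hpre hb).1 hg⟩, ⟨hr', hre⟩, ih _ _ hb⟩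
    · rintro a ⟨⟨g', e'⟩, hg'⟩ ⟨hr', hre⟩
      obtain ⟨g, hr, hb⟩ := h.2.2 a g' hr'
      exact ⟨⟨(g, e'), (hpre hb).2 hg'⟩, ⟨hr, hre⟩, ih _ _ hb⟩

/-- Worlds of iterated updates, together with the number of updates. -/
abbrev History (M : EpistemicModel.{u, v} σ n D) (E : ActionModel σ n) : Type v :=
  Σ k : ℕ, (M.iterUpdate E k).World

/-- Bounded bisimilarity of histories of possibly different lengths. -/
abbrev HBisim (M : EpistemicModel.{u, v} σ n D) (E : ActionModel σ n) (m : ℕ)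
    (H H' : History M E) : Prop :=
  NBisim m (M.iterUpdate E H.1) (M.iterUpdate E H'.1) H.2 H'.2

/-- Some history that extends `H` by exactly `t` events satisfies the goal. -/
def CanReach (M : EpistemicModel.{u, v} σ n D) (E : ActionModel σ n) (goal : Formula σ n) :
    ℕ → History M E → Prop
  | 0, H => Holds (M.iterUpdate E H.1) H.2 goal
  | t + 1, H => ∃ (e : Fin E.numEvents) (he : Holds (M.iterUpdate E H.1) H.2 (E.pre e)),
      CanReach M E goal t ⟨H.1 + 1, ⟨(H.2, e), he⟩⟩

variable {M : EpistemicModel.{u, v} σ n D} {E : ActionModel σ n} {goal : Formula σ n}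

theorem HBisim.canReach {m : ℕ} (hE : E.NonModal) (hm : goal.modalDepth ≤ m) :
    ∀ {t : ℕ} {H H' : History M E}, HBisim M E m H H' → CanReach M E goal t H →
      CanReach M E goal t H'
  | 0, _, _, h, hr => (NBisim.holds_iff h hm).1 hr
  | t + 1, H, H', h, ⟨e, he, hr⟩ => by
    have he' : Holds (M.iterUpdate E H'.1) H'.2 (E.pre e) := by
      refine (NBisim.holds_iff h ?_).1 he
      rw [(hE.1 e).modalDepth_eq]
      exact Nat.zero_le _
    exact ⟨e, he', HBisim.canReach (m := m) hE hm
      (H := ⟨H.1 + 1, ⟨(H.2, e), he⟩⟩) (H' := ⟨H'.1 + 1, ⟨(H'.2, e), he'⟩⟩)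
      (NBisim.update hE he he' h) hr⟩

theorem CanReach.exists_history : ∀ {t : ℕ} {H : History M E}, CanReach M E goal t H →
    ∃ H' : History M E, H'.1 = H.1 + t ∧ M.root E H'.1 H'.2 = M.root E H.1 H.2 ∧
      Holds (M.iterUpdate E H'.1) H'.2 goal
  | 0, H, h => ⟨H, rfl, rfl, h⟩
  | t + 1, H, ⟨e, he, h⟩ => by
    obtain ⟨H', h₁, h₂, h₃⟩ := h.exists_history
    exact ⟨H', by rw [h₁]; simp only; omega, h₂, h₃⟩

theorem CanReach.of_history {w : M.World} : ∀ (k : ℕ) (h : (M.iterUpdate E k).World) (t : ℕ),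
    M.root E k h = w → CanReach M E goal t ⟨k, h⟩ →
      CanReach M E goal (t + k) ⟨0, w⟩
  | 0, h, t, hw, hr => by
    subst hw
    exact hr
  | k + 1, ⟨(h, e), he⟩, t, hw, hr => by
    have := CanReach.of_history k h (t + 1) hw ⟨e, he, hr⟩
    rwa [show t + (k + 1) = t + 1 + k by omega]

/-- If a labelling of the histories by finitely many labels refines bounded bisimilarity, then a
goal that can be reached can be reached in fewer steps than there are labels: along a shortest path
to the goal, the distance to the goal takes different values, and it is determined by the label. -/
theorem exists_short_canReach {m : ℕ} (hE : E.NonModal) (hm : goal.modalDepth ≤ m) {X : Type}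
    [Finite X] {lab : History M E → X} (hlab : ∀ H H', lab H = lab H' → HBisim M E m H H')
    {t : ℕ} {H₀ : History M E} (h : CanReach M E goal t H₀) :
    ∃ s < Nat.card X, CanReach M E goal s H₀ := by
  classical
  have hex : ∃ s, CanReach M E goal s H₀ := ⟨t, h⟩
  obtain ⟨s, hs, hmin⟩ : ∃ s, CanReach M E goal s H₀ ∧ ∀ s' < s, ¬ CanReach M E goal s' H₀ :=
    ⟨Nat.find hex, Nat.find_spec hex, fun s' hs' => Nat.find_min hex hs'⟩
  have key : ∀ r ≤ s, ∃ H, CanReach M E goal r H ∧ ∀ r' < r, ¬ CanReach M E goal r' H := by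
    intro r hr
    induction hr using Nat.decreasingInduction with
    | self => exact ⟨H₀, hs, hmin⟩
    | of_succ r _ ih =>
      obtain ⟨H, ⟨e, he, hH⟩, hmin⟩ := ih
      exact ⟨_, hH, fun r' hr' h' => hmin (r' + 1) (by omega) ⟨e, he, h'⟩⟩
  have : Nonempty (History M E) := ⟨H₀⟩
  choose! G hG hGmin using key
  have hinj : Function.Injective fun r : Fin (s + 1) => lab (G r) := by
    intro r r' hrr
    have h₁ : ¬ (r : ℕ) < r' := fun hlt =>
      hGmin r' (by omega) r hlt ((hlab _ _ hrr).canReach hE hm (hG r (by omega)))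
    have h₂ : ¬ (r' : ℕ) < r := fun hlt =>
      hGmin r (by omega) r' hlt ((hlab _ _ hrr.symm).canReach hE hm (hG r' (by omega)))
    exact Fin.ext (by omega)
  have hcard := Nat.card_le_card_of_injective _ hinj
  rw [Nat.card_eq_fintype_card, Fintype.card_fin] at hcard
  exact ⟨s, by omega, hs⟩

/-- If finitely many types of assignments determine the atoms of the initial model, then finitely
many labels of histories determine bounded bisimilarity: the structure at a history is a union of
types, and for each further step of bisimulation the labels of the accessible histories are added to
the label. -/
theorem exists_label [Nonempty D] {Z V : ℕ} (hV : 0 < V) (hE : E.NonModal)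
    (hE' : E.QuantifierFreePost) (hp : ∀ e p, (E.post e p).VarsLT V) (har : ∀ p, σ.arity p ≤ V)
    (hpred : σ.numPred ≤ Z) (hn : n ≤ Z) {Q : Type} [Finite Q] (hQ : Nat.card Q ≤ baseBound Z V)
    {typ : (ℕ → D) → Q} (htyp : ∀ ν ν', typ ν = typ ν' → AtomEquiv M V ν ν') (m : ℕ) :
    ∃ (X : Type) (_ : Finite X) (lab : History M E → X), Nat.card X ≤ labelBound Z V m ∧
      ∀ H H', lab H = lab H' → HBisim M E m H H' := by
  classical
  induction m with
  | zero =>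
    obtain ⟨d₀⟩ := ‹Nonempty D›
    let ext : (p : Fin σ.numPred) → (Fin (σ.arity p) → D) → ℕ → D := fun p d i =>
      if hi : i < σ.arity p then d ⟨i, hi⟩ else d₀
    let lab : History M E → Fin σ.numPred → Set Q := fun H p =>
      {q | ∃ d ∈ (M.iterUpdate E H.1).interp H.2 p, typ (ext p d) = q}
    have hsub : ∀ H H', lab H = lab H' → ∀ p, (M.iterUpdate E H.1).interp H.2 p ⊆
        (M.iterUpdate E H'.1).interp H'.2 p := by
      intro H H' hl p d hd
      have h₁ : typ (ext p d) ∈ lab H p := ⟨d, hd, rfl⟩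
      rw [hl] at h₁
      obtain ⟨d', hd', ht⟩ := h₁
      have h₂ := (htyp _ _ ht).iterUpdate hV hE hE' hp H'.1 H'.2 p (fun i => i)
        fun i => lt_of_lt_of_le i.2 (har p)
      simpa [ext, hd'] using h₂
    refine ⟨Fin σ.numPred → Set Q, inferInstance, lab, ?_, fun H H' hl => ?_⟩
    · have := Fintype.ofFinite Q
      rw [Nat.card_eq_fintype_card] at hQ
      rw [Nat.card_eq_fintype_card, Fintype.card_fun, Fintype.card_set, Fintype.card_fin]
      exact (Nat.pow_le_pow_left (Nat.pow_le_pow_right two_pos hQ) _).trans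
        (Nat.pow_le_pow_right (by positivity) hpred)
    · exact funext fun p => (hsub H H' hl p).antisymm (hsub H' H hl.symm p)
  | succ m ih =>
    obtain ⟨X, hX, lab, hcard, hlab⟩ := ih
    let acc : History M E → Fin n → Set X := fun H a =>
      {x | ∃ g, (M.iterUpdate E H.1).rel a H.2 g ∧ lab ⟨H.1, g⟩ = x}
    refine ⟨X × (Fin n → Set X), inferInstance, fun H => (lab H, acc H), ?_, fun H H' hl => ?_⟩
    · have := Fintype.ofFinite X
      rw [Nat.card_eq_fintype_card] at hcard
      rw [Nat.card_eq_fintype_card, Fintype.card_prod, Fintype.card_fun, Fintype.card_set,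
        Fintype.card_fin]
      exact Nat.mul_le_mul hcard ((Nat.pow_le_pow_left (Nat.pow_le_pow_right two_pos hcard) _).trans
        (Nat.pow_le_pow_right (by positivity) hn))
    · obtain ⟨h₁, h₂⟩ : lab H = lab H' ∧ acc H = acc H' := Prod.ext_iff.1 hl
      refine ⟨NBisim.interp_eq (hlab H H' h₁), fun a g hg => ?_, fun a g' hg' => ?_⟩
      · have : lab ⟨H.1, g⟩ ∈ acc H a := ⟨g, hg, rfl⟩
        rw [h₂] at this
        obtain ⟨g', hg', he⟩ := this
        exact ⟨g', hg', hlab ⟨_, g⟩ ⟨_, g'⟩ he.symm⟩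
      · have : lab ⟨H'.1, g'⟩ ∈ acc H' a := ⟨g', hg', rfl⟩
        rw [← h₂] at this
        obtain ⟨g, hg, he⟩ := this
        exact ⟨g, hg, hlab ⟨_, g⟩ ⟨_, g'⟩ he⟩

end Bisimulation

/-! ### Automata reading several words in parallel -/

section Runs

variable {ι α β Q : Type*}

/-- The `j`-th letters of a family of words, with `none` beyond the end of a word. -/
def column (u : ι → List α) (j : ℕ) : ι → Option α := fun y => (u y)[j]?

/-- The state that the deterministic automaton with transition function `δ` and initial state `q₀`
reaches on the first `T` columns of a family of words. -/
def run (δ : Q → (ι → Option α) → Q) (q₀ : Q) (u : ι → List α) : ℕ → Q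
  | 0 => q₀
  | T + 1 => δ (run δ q₀ u T) (column u T)

variable {δ : Q → (ι → Option α) → Q} {q₀ : Q}

theorem run_add_congr {u u' : ι → List α} {T T' : ℕ} (h₀ : run δ q₀ u T = run δ q₀ u' T') :
    ∀ s, (∀ j < s, column u (T + j) = column u' (T' + j)) →
      run δ q₀ u (T + s) = run δ q₀ u' (T' + s)
  | 0, _ => h₀
  | s + 1, h => by
    change δ (run δ q₀ u (T + s)) (column u (T + s)) = δ (run δ q₀ u' (T' + s)) (column u' (T' + s))
    rw [run_add_congr h₀ s fun j hj => h j (by omega), h s (by omega)]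

theorem run_congr {u u' : ι → List α} {T : ℕ} (h : ∀ j < T, column u j = column u' j) :
    run δ q₀ u T = run δ q₀ u' T := by
  simpa using run_add_congr (δ := δ) (q₀ := q₀) (T := 0) (T' := 0) (u := u) (u' := u') rfl T
    (by simpa using h)

theorem column_eq_none {u : ι → List α} {T j : ℕ} (hu : ∀ y, (u y).length ≤ T) (hj : T ≤ j) :
    column u j = fun _ => none :=
  funext fun y => List.getElem?_eq_none ((hu y).trans hj)

theorem column_update [DecidableEq ι] (u : ι → List α) (x : ι) (d : List α) (j : ℕ) :
    column (Function.update u x d) j = Function.update (column u j) x d[j]? := by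
  funext y
  by_cases h : y = x
  · subst h; simp [column]
  · simp [column, h]

theorem getElem?_take_append_drop (l : List α) {i j : ℕ} (hij : i ≤ j) (t : ℕ) :
    (l.take i ++ l.drop j)[t]? = if t < i then l[t]? else l[t + (j - i)]? := by
  rw [List.getElem?_append, List.length_take]
  by_cases h : t < i
  · by_cases h' : t < l.length
    · simp [h, h']
    · simp only [h, if_true, show ¬ t < min i l.length by omega, if_false]
      rw [List.getElem?_drop, List.getElem?_eq_none (by omega), List.getElem?_eq_none (by omega)]
  · simp only [h, if_false, show ¬ t < min i l.length by omega, List.getElem?_drop]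
    by_cases h' : i ≤ l.length
    · congr 1; omega
    · rw [List.getElem?_eq_none (by omega), List.getElem?_eq_none (by omega)]

/-- Pumping: all words of a family can be shortened at once, without changing the state reached, to
length at most `ℓ` plus the number of states, where words of length at most `ℓ` do not change. -/
theorem exists_short_run [Finite Q] (ℓ : ℕ) : ∀ (T : ℕ) (u : ι → List α),
    (∀ y, (u y).length ≤ T) → ∃ (u' : ι → List α) (T' : ℕ), (∀ y, (u' y).length ≤ T') ∧
      T' ≤ ℓ + Nat.card Q ∧ run δ q₀ u T = run δ q₀ u' T' ∧
      ∀ y, (u y).length ≤ ℓ → u' y = u y := by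
  intro T
  induction T using Nat.strong_induction_on with
  | _ T ih =>
    intro u hu
    by_cases hT : T ≤ ℓ + Nat.card Q
    · exact ⟨u, T, hu, hT, rfl, fun _ _ => rfl⟩
    obtain ⟨i, j, hij, hrun⟩ : ∃ i j : Fin (Nat.card Q + 1), i < j ∧
        run δ q₀ u (ℓ + i) = run δ q₀ u (ℓ + j) := by
      have hninj : ¬ Function.Injective fun i : Fin (Nat.card Q + 1) => run δ q₀ u (ℓ + i) := by
        intro hinj
        have := Nat.card_le_card_of_injective _ hinj
        rw [Nat.card_eq_fintype_card, Fintype.card_fin] at this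
        omega
      simp only [Function.Injective, not_forall] at hninj
      obtain ⟨i, j, h, hne⟩ := hninj
      rcases lt_or_gt_of_ne hne with hlt | hlt
      · exact ⟨i, j, hlt, h⟩
      · exact ⟨j, i, hlt, h.symm⟩
    have hij' : (i : ℕ) < j := hij
    have hj := j.2
    obtain ⟨s, rfl⟩ : ∃ s, T = ℓ + j + s := ⟨T - (ℓ + j), by omega⟩
    let u₁ : ι → List α := fun y => (u y).take (ℓ + i) ++ (u y).drop (ℓ + j)
    have hcol : ∀ t, column u₁ t = if t < ℓ + i then column u t
        else column u (t + (ℓ + j - (ℓ + i))) := by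
      intro t
      funext y
      simp only [column, u₁]
      rw [getElem?_take_append_drop _ (by omega)]
      split_ifs <;> rfl
    have hu₁ : ∀ y, (u₁ y).length ≤ ℓ + i + s := by
      intro y
      have := hu y
      simp only [u₁, List.length_append, List.length_take, List.length_drop]
      omega
    have h₁ : run δ q₀ u₁ (ℓ + i) = run δ q₀ u (ℓ + j) := by
      rw [← hrun]
      exact run_congr fun t ht => by rw [hcol, if_pos ht]
    have h₂ : run δ q₀ u₁ (ℓ + i + s) = run δ q₀ u (ℓ + j + s) :=
      run_add_congr h₁ s fun t _ => by
        rw [hcol, if_neg (by omega)]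
        congr 1
        omega
    obtain ⟨u', T', hu', hT', hrun', heq⟩ := ih (ℓ + i + s) (by omega) u₁ hu₁
    have hfix : ∀ y, (u y).length ≤ ℓ → u₁ y = u y := by
      intro y hy
      simp only [u₁]
      rw [List.take_of_length_le (by omega), List.drop_eq_nil_of_le (by omega), List.append_nil]
    refine ⟨u', T', hu', hT', h₂.symm.trans hrun', fun y hy => ?_⟩
    rw [heq y (by rw [hfix y hy]; exact hy), hfix y hy]

section Lift

variable [DecidableEq ι]

/-- The transition function of the automaton for quantifiers. Besides a state of the given
automaton, it records for each track `x` the set of the states that are reached when the word on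
track `x` is replaced by some word as long as the part of the input that has been read, and the set
of those reached when it is replaced by some shorter word. -/
def liftStep (δ : Q → (ι → Option α) → Q) (q : Q × (ι → Set Q × Set Q)) (c : ι → Option α) :
    Q × (ι → Set Q × Set Q) :=
  (δ q.1 c, fun x =>
    ({q' | ∃ p ∈ (q.2 x).1, ∃ a : α, q' = δ p (Function.update c x (some a))},
      {q' | ∃ p, (p ∈ (q.2 x).1 ∨ p ∈ (q.2 x).2) ∧ q' = δ p (Function.update c x none)}))

/-- The initial state of the automaton for quantifiers. -/
def liftInit (q₀ : Q) : Q × (ι → Set Q × Set Q) := (q₀, fun _ => ({q₀}, ∅))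

theorem run_update_take (u : ι → List α) (x : ι) (d : List α) (T : ℕ) :
    run δ q₀ (Function.update u x (d.take T)) T = run δ q₀ (Function.update u x d) T :=
  run_congr fun j hj => by
    rw [column_update, column_update, List.getElem?_take, if_pos hj]

theorem run_lift (u : ι → List α) (T : ℕ) :
    run (liftStep δ) (liftInit q₀) u T = (run δ q₀ u T, fun x =>
      ({q | ∃ d : List α, d.length = T ∧ q = run δ q₀ (Function.update u x d) T},
        {q | ∃ d : List α, d.length < T ∧ q = run δ q₀ (Function.update u x d) T})) := by
  induction T with
  | zero => simp [run, liftInit]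
  | succ T ih =>
    have hs : ∀ x (d : List α), run δ q₀ (Function.update u x d) (T + 1) =
        δ (run δ q₀ (Function.update u x (d.take T)) T)
          (Function.update (column u T) x d[T]?) := by
      intro x d
      rw [run_update_take, ← column_update]
      rfl
    change liftStep δ (run (liftStep δ) (liftInit q₀) u T) (column u T) = _
    rw [ih]
    refine Prod.ext rfl (funext fun x => Prod.ext (Set.ext fun q => ?_) (Set.ext fun q => ?_))
    · constructor
      · rintro ⟨_, ⟨d, hd, rfl⟩, a, rfl⟩
        refine ⟨d ++ [a], by simp [hd], ?_⟩
        rw [hs]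
        simp [← hd]
      · rintro ⟨d, hd, rfl⟩
        refine ⟨_, ⟨d.take T, by simp [hd], rfl⟩, d[T], ?_⟩
        rw [hs, List.getElem?_eq_getElem]
    · constructor
      · rintro ⟨_, ⟨d, hd, rfl⟩ | ⟨d, hd, rfl⟩, rfl⟩
        · refine ⟨d, by omega, ?_⟩
          rw [hs, List.take_of_length_le (by omega), List.getElem?_eq_none (by omega)]
        · refine ⟨d, by omega, ?_⟩
          rw [hs, List.take_of_length_le (by omega), List.getElem?_eq_none (by omega)]
      · rintro ⟨d, hd, rfl⟩
        rw [hs, List.take_of_length_le (by omega), List.getElem?_eq_none (by omega)]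
        refine ⟨_, ?_, rfl⟩
        rcases (Nat.lt_succ_iff_lt_or_eq.1 hd) with h | h
        · exact Or.inr ⟨d, h, rfl⟩
        · exact Or.inl ⟨d, h, rfl⟩

/-- If the automaton for quantifiers does not distinguish two families of words, then any
replacement of a word in one of them is matched by a replacement in the other, up to the states of
the given automaton. -/
theorem exists_run_update_eq {u u' : ι → List α} {T T' : ℕ} (hu : ∀ y, (u y).length ≤ T)
    (hu' : ∀ y, (u' y).length ≤ T')
    (h : run (liftStep δ) (liftInit q₀) u T = run (liftStep δ) (liftInit q₀) u' T')
    (x : ι) (d : List α) : ∃ (d' : List α) (S S' : ℕ),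
      (∀ y, (Function.update u x d y).length ≤ S) ∧
      (∀ y, (Function.update u' x d' y).length ≤ S') ∧
      run δ q₀ (Function.update u x d) S = run δ q₀ (Function.update u' x d') S' := by
  have hlen : ∀ {v : ι → List α} {R S : ℕ} {e : List α}, (∀ y, (v y).length ≤ R) → R ≤ S →
      e.length ≤ S → ∀ y, (Function.update v x e y).length ≤ S := by
    intro v R S e hv hRS he y
    by_cases hy : y = x
    · subst hy; simpa using he
    · simpa [hy] using (hv y).trans hRS
  rw [run_lift, run_lift] at h
  have h₁ := congrArg Prod.fst (congrFun (congrArg Prod.snd h) x)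
  have h₂ := congrArg Prod.snd (congrFun (congrArg Prod.snd h) x)
  simp only at h₁ h₂
  rcases lt_trichotomy d.length T with hd | hd | hd
  · have hm : run δ q₀ (Function.update u x d) T ∈
        {q | ∃ d : List α, d.length < T ∧ q = run δ q₀ (Function.update u x d) T} := ⟨d, hd, rfl⟩
    rw [h₂] at hm
    obtain ⟨d', hd', he⟩ := hm
    exact ⟨d', T, T', hlen hu le_rfl hd.le, hlen hu' le_rfl hd'.le, he⟩
  · have hm : run δ q₀ (Function.update u x d) T ∈
        {q | ∃ d : List α, d.length = T ∧ q = run δ q₀ (Function.update u x d) T} := ⟨d, hd, rfl⟩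
    rw [h₁] at hm
    obtain ⟨d', hd', he⟩ := hm
    exact ⟨d', T, T', hlen hu le_rfl hd.le, hlen hu' le_rfl hd'.le, he⟩
  · have hm : run δ q₀ (Function.update u x (d.take T)) T ∈
        {q | ∃ d : List α, d.length = T ∧ q = run δ q₀ (Function.update u x d) T} :=
      ⟨d.take T, by simp [hd.le], rfl⟩
    rw [h₁] at hm
    obtain ⟨d', hd', he⟩ := hm
    obtain ⟨s, hs⟩ : ∃ s, d.length = T + s := ⟨d.length - T, by omega⟩
    refine ⟨d' ++ d.drop T, T + s, T' + s, hlen hu (by omega) hs.le,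
      hlen hu' (by omega) (by simp [hd', hs]), run_add_congr ?_ s fun j _ => ?_⟩
    · rw [run_update_take] at he
      rw [he, ← run_update_take u' x (d' ++ d.drop T), ← hd', List.take_left]
    · rw [column_update, column_update, column_eq_none hu (by omega),
        column_eq_none hu' (by omega), List.getElem?_append_right (by omega), List.getElem?_drop]
      congr 2
      omega

end Lift

/-- The subset construction for an automaton `𝒜`, each of whose letters is computed from a column
of the input; where `g` is undefined, nothing is read. -/
def subsetStep {S : Type*} (𝒜 : NFA β S) (g : (ι → Option α) → Option β) (X : Set S)
    (c : ι → Option α) : Set S :=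
  (g c).elim X fun b => 𝒜.stepSet X b

theorem run_subsetStep {S : Type*} (𝒜 : NFA β S) (g : (ι → Option α) → Option β)
    {u : ι → List α} {w : List β} (hw : ∀ j, w[j]? = g (column u j)) (T : ℕ) :
    run (subsetStep 𝒜 g) 𝒜.start u T = 𝒜.eval (w.take T) := by
  induction T with
  | zero => rfl
  | succ T ih =>
    change subsetStep 𝒜 g (run (subsetStep 𝒜 g) 𝒜.start u T) (column u T) = _
    rw [ih, List.take_add_one, subsetStep, ← hw]
    cases h : w[T]? with
    | none => simp
    | some b => simp

end Runs

/-! ### Automata that determine the truth of formulas -/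

section Resolves

variable {σ : Signature} {n : ℕ} {D : Type u} {α Q : Type} {V r : ℕ}

/-- The automaton `(δ, q₀)` reading `V` words in parallel determines which of its words belong to
`enc D`, and the truth of the formulas of quantifier depth at most `r` with variables below `V` on the
assignments whose values these words encode. -/
structure Resolves (M : EpistemicModel.{u, v} σ n D) (enc : D → List α) (V r : ℕ)
    (δ : Q → (Fin V → Option α) → Q) (q₀ : Q) : Prop where
  dom : ∀ (u u' : Fin V → List α) (T T' : ℕ), (∀ y, (u y).length ≤ T) →
    (∀ y, (u' y).length ≤ T') → run δ q₀ u T = run δ q₀ u' T' →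
      ∀ y, u y ∈ Set.range enc → u' y ∈ Set.range enc
  sat : ∀ φ : Formula σ n, φ.VarsLT V → φ.quantDepth ≤ r → ∀ (w : M.World) (ν ν' : ℕ → D)
    (T T' : ℕ), (∀ y : Fin V, (enc (ν y)).length ≤ T) → (∀ y : Fin V, (enc (ν' y)).length ≤ T') →
      run δ q₀ (fun y => enc (ν y)) T = run δ q₀ (fun y => enc (ν' y)) T' →
        (Sat M w ν φ ↔ Sat M w ν' φ)

variable {M : EpistemicModel.{u, v} σ n D} {enc : D → List α}
  {δ : Q → (Fin V → Option α) → Q} {q₀ : Q}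

theorem Resolves.of_atomEquiv
    (hdom : ∀ (u u' : Fin V → List α) (T T' : ℕ), (∀ y, (u y).length ≤ T) →
      (∀ y, (u' y).length ≤ T') → run δ q₀ u T = run δ q₀ u' T' →
        ∀ y, u y ∈ Set.range enc → u' y ∈ Set.range enc)
    (h : ∀ (ν ν' : ℕ → D) (T T' : ℕ), (∀ y : Fin V, (enc (ν y)).length ≤ T) →
      (∀ y : Fin V, (enc (ν' y)).length ≤ T') →
      run δ q₀ (fun y => enc (ν y)) T = run δ q₀ (fun y => enc (ν' y)) T' → AtomEquiv M V ν ν') :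
    Resolves M enc V 0 δ q₀ := by
  refine ⟨hdom, fun φ hφ hr w ν ν' T T' hT hT' hrun => ?_⟩
  have hat := h ν ν' T T' hT hT' hrun
  induction φ generalizing w with
  | atom p x => exact hat w p x hφ
  | neg φ ih => exact not_congr (ih hφ hr w)
  | conj φ ψ ih₁ ih₂ =>
    exact and_congr (ih₁ hφ.1 ((le_max_left _ _).trans hr) w)
      (ih₂ hφ.2 ((le_max_right _ _).trans hr) w)
  | all x φ ih => exact absurd hr (Nat.not_succ_le_zero _)
  | box a φ ih => exact forall_congr' fun w' => imp_congr_right fun _ => ih hφ hr w'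

theorem enc_update (ν : ℕ → D) (x : Fin V) (d : D) :
    (fun y : Fin V => enc (Function.update ν x d y)) =
      Function.update (fun y : Fin V => enc (ν y)) x (enc d) := by
  funext y
  by_cases h : y = x
  · subst h; simp
  · have h' : (y : ℕ) ≠ x := fun h' => h (Fin.ext h')
    simp [h, h']

/-- The automaton for quantifiers resolves formulas of one more quantifier depth. -/
theorem Resolves.lift (h : Resolves M enc V r δ q₀) :
    Resolves M enc V (r + 1) (liftStep δ) (liftInit q₀) := by
  have hfst : ∀ {u u' : Fin V → List α} {T T' : ℕ},
      run (liftStep δ) (liftInit q₀) u T = run (liftStep δ) (liftInit q₀) u' T' →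
        run δ q₀ u T = run δ q₀ u' T' := by
    intro u u' T T' he
    rw [run_lift, run_lift] at he
    exact congrArg Prod.fst he
  refine ⟨fun u u' T T' hu hu' he => h.dom u u' T T' hu hu' (hfst he),
    fun φ hφ hr w ν ν' T T' hT hT' he => ?_⟩
  induction φ generalizing w with
  | atom p x => exact h.sat _ hφ (Nat.zero_le _) w ν ν' T T' hT hT' (hfst he)
  | neg φ ih => exact not_congr (ih hφ hr w)
  | conj φ ψ ih₁ ih₂ =>
    exact and_congr (ih₁ hφ.1 ((le_max_left _ _).trans hr) w)
      (ih₂ hφ.2 ((le_max_right _ _).trans hr) w)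
  | all x φ ih =>
    have key : ∀ {ν ν' : ℕ → D} {T T' : ℕ}, (∀ y : Fin V, (enc (ν y)).length ≤ T) →
        (∀ y : Fin V, (enc (ν' y)).length ≤ T') →
        run (liftStep δ) (liftInit q₀) (fun y => enc (ν y)) T =
          run (liftStep δ) (liftInit q₀) (fun y => enc (ν' y)) T' →
        Sat M w ν (.all x φ) → Sat M w ν' (.all x φ) := by
      intro ν ν' T T' hT hT' he hs d'
      obtain ⟨e, S', S, hS', hS, hrun⟩ :=
        exists_run_update_eq (δ := δ) (q₀ := q₀) hT' hT he.symm ⟨x, hφ.1⟩ (enc d')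
      obtain ⟨d, rfl⟩ : e ∈ Set.range enc := by
        have := h.dom _ _ S' S hS' hS hrun ⟨x, hφ.1⟩
        simp only [Function.update_self] at this
        exact this ⟨d', rfl⟩
      rw [← enc_update ν', ← enc_update ν] at hrun
      refine (h.sat φ hφ.2 (Nat.le_of_succ_le_succ hr) w _ _ S' S (fun y => ?_) (fun y => ?_)
        hrun).2 (hs d)
      · exact (congrArg List.length (congrFun (enc_update ν' ⟨x, hφ.1⟩ d') y)).trans_le (hS' y)
      · exact (congrArg List.length (congrFun (enc_update ν ⟨x, hφ.1⟩ d) y)).trans_le (hS y)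
    exact ⟨key hT hT' he, key hT' hT he.symm⟩
  | box a φ ih => exact forall_congr' fun w' => imp_congr_right fun _ => ih hφ hr w'

theorem Resolves.exists_iterate {Z : ℕ} (hQ : Finite Q) (hcard : Nat.card Q ≤ baseBound Z V)
    (h : Resolves M enc V 0 δ q₀) (r : ℕ) :
    ∃ (Q' : Type) (_ : Finite Q') (δ' : Q' → (Fin V → Option α) → Q') (q₀' : Q'),
      Nat.card Q' ≤ stateBound Z V r ∧ Resolves M enc V r δ' q₀' := by
  induction r with
  | zero => exact ⟨Q, hQ, δ, q₀, hcard, h⟩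
  | succ r ih =>
    obtain ⟨Q', hQ', δ', q₀', hc, hr⟩ := ih
    refine ⟨_, inferInstance, liftStep δ', liftInit q₀', ?_, hr.lift⟩
    classical
    have := Fintype.ofFinite Q'
    rw [Nat.card_eq_fintype_card] at hc
    rw [Nat.card_eq_fintype_card, Fintype.card_prod, Fintype.card_fun, Fintype.card_prod,
      Fintype.card_set, Fintype.card_fin]
    have h2 : 2 ^ Fintype.card Q' ≤ 2 ^ stateBound Z V r := Nat.pow_le_pow_right two_pos hc
    exact Nat.mul_le_mul hc (Nat.pow_le_pow_left (Nat.mul_le_mul h2 h2) _)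

/-- The values of an assignment at which a formula of quantifier depth at most `r` with variables
below `V` is true can be replaced by short ones, without changing its truth: values of size at most
`ℓ` are kept, the others get size at most `ℓ + N`. -/
def HasShortWitnesses (M : EpistemicModel.{u, v} σ n D) (size : D → ℕ) (V N r : ℕ) : Prop :=
  ∀ φ : Formula σ n, φ.VarsLT V → φ.quantDepth ≤ r → ∀ (w : M.World) (ν : ℕ → D) (ℓ : ℕ),
    ∃ ν' : ℕ → D, (∀ y, V ≤ y → ν' y = ν y) ∧ (∀ y, size (ν y) ≤ ℓ → ν' y = ν y) ∧
      (∀ y < V, size (ν' y) ≤ ℓ + N) ∧ (Sat M w ν φ ↔ Sat M w ν' φ)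

theorem Resolves.hasShortWitnesses [Finite Q] {N : ℕ} (henc : Function.Injective enc)
    (hN : Nat.card Q ≤ N) (h : Resolves M enc V r δ q₀) :
    HasShortWitnesses M (fun d => (enc d).length) V N r := by
  intro φ hφ hr w ν ℓ
  obtain ⟨T, hT⟩ : ∃ T, ∀ y : Fin V, (enc (ν y)).length ≤ T :=
    ⟨Finset.univ.sup fun y : Fin V => (enc (ν y)).length,
      fun y => Finset.le_sup (f := fun y : Fin V => (enc (ν y)).length) (Finset.mem_univ y)⟩
  obtain ⟨u', T', hu', hT', hrun, hfix⟩ :=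
    exists_short_run (δ := δ) (q₀ := q₀) ℓ T (fun y : Fin V => enc (ν y)) hT
  have hmem : ∀ y, ∃ d, enc d = u' y := fun y => h.dom _ _ T T' hT hu' hrun y ⟨_, rfl⟩
  choose f hf using hmem
  let ν' : ℕ → D := fun y => if hy : y < V then f ⟨y, hy⟩ else ν y
  have hν' : ∀ y : Fin V, ν' y = f y := fun y => by simp [ν']
  have henc' : (fun y : Fin V => enc (ν' y)) = u' := funext fun y => by rw [hν', hf]
  refine ⟨ν', fun y hy => by simp [ν', hy.not_gt], fun y hy => ?_, fun y hy => ?_, ?_⟩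
  · by_cases hyV : y < V
    · have := hfix ⟨y, hyV⟩ hy
      rw [← hf] at this
      exact (hν' ⟨y, hyV⟩).trans (henc this)
    · simp [ν', hyV]
  · change (enc (ν' y)).length ≤ _
    rw [show ν' y = f ⟨y, hy⟩ from hν' ⟨y, hy⟩, hf]
    exact ((hu' _).trans hT').trans (Nat.add_le_add_left hN _)
  · exact h.sat φ hφ hr w ν ν' T T' hT
      (fun y => (congrArg List.length (congrFun henc' y)).trans_le (hu' y)) (by rw [henc', hrun])

end Resolves

/-! ### The automaton of an automatic presentation -/

section BaseAutomaton

/-- The nondeterministic automaton given by finite tables. -/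
def FinAut.nfa {A : Type} (𝒜 : FinAut A) : NFA A (Fin 𝒜.numStates) where
  step q a := {q' | (q, a, q') ∈ 𝒜.trans}
  start := {q | q ∈ 𝒜.start}
  accept := {q | q ∈ 𝒜.accept}

theorem FinAut.mem_language_iff {A : Type} (𝒜 : FinAut A) (w : List A) :
    w ∈ 𝒜.language ↔ ∃ q ∈ 𝒜.nfa.accept, q ∈ 𝒜.nfa.eval w :=
  Iff.rfl

open Classical in
/-- The letter of the convolution of the tracks `x 0, x 1, …` that a column gives, if the column is
not beyond the end of all these tracks. -/
noncomputable def convLetter {α : Type} {V k : ℕ} (x : Fin k → Fin V) (c : Fin V → Option α) :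
    Option (Fin k → Option α) :=
  if ∀ i, c (x i) = none then none else some fun i => c (x i)

theorem getElem?_conv {α : Type} {V k : ℕ} (x : Fin k → Fin V) (u : Fin V → List α) (j : ℕ) :
    (conv fun i => u (x i))[j]? = convLetter x (column u j) := by
  unfold conv convLetter
  rw [List.getElem?_map]
  by_cases h : j < Finset.univ.sup fun i => (u (x i)).length
  · rw [List.getElem?_range h, if_neg]
    · rfl
    · intro hn
      obtain ⟨i, -, hi⟩ := (Finset.lt_sup_iff).1 h
      have := hn i
      simp only [column, List.getElem?_eq_none_iff] at this
      omega
  · rw [List.getElem?_eq_none (by simpa using h), if_pos]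
    · rfl
    · intro i
      exact List.getElem?_eq_none ((Finset.le_sup (f := fun i => (u (x i)).length)
        (Finset.mem_univ i)).trans (not_lt.1 h))

variable {σ : Signature} {n : ℕ} {D : Type u} {M : EpistemicModel.{u, v} σ n D}

/-- The states of the automaton that runs the automata of the predicates on all tuples of tracks,
and the automaton of the domain on all tracks. -/
abbrev BaseState (P : M.AutomaticPresentation) (V : ℕ) : Type :=
  ((i : Fin P.numWorlds) → (p : Fin σ.numPred) → (Fin (σ.arity p) → Fin V) →
    Set (Fin (P.predAut i p).numStates)) × (Fin V → Set (Fin P.domAut.numStates))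

/-- The transition function of this product automaton. -/
noncomputable def baseStep (P : M.AutomaticPresentation) (V : ℕ) (q : BaseState P V)
    (c : Fin V → Option (Fin P.alphabet)) : BaseState P V :=
  (fun i p x => subsetStep (P.predAut i p).nfa (convLetter x) (q.1 i p x) c,
    fun y => subsetStep P.domAut.nfa (fun c => c y) (q.2 y) c)

/-- The initial state of this product automaton. -/
def baseInit (P : M.AutomaticPresentation) (V : ℕ) : BaseState P V :=
  (fun i p _ => (P.predAut i p).nfa.start, fun _ => P.domAut.nfa.start)

theorem run_base (P : M.AutomaticPresentation) (V : ℕ) (u : Fin V → List (Fin P.alphabet))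
    (T : ℕ) : run (baseStep P V) (baseInit P V) u T =
      (fun i p x => (P.predAut i p).nfa.eval ((conv fun i => u (x i)).take T),
        fun y => P.domAut.nfa.eval ((u y).take T)) := by
  have h : run (baseStep P V) (baseInit P V) u T =
      (fun i p x => run (subsetStep (P.predAut i p).nfa (convLetter x)) (P.predAut i p).nfa.start u T,
        fun y => run (subsetStep P.domAut.nfa fun c => c y) P.domAut.nfa.start u T) := by
    induction T with
    | zero => rfl
    | succ T ih =>
      change baseStep P V (run (baseStep P V) (baseInit P V) u T) (column u T) = _
      rw [ih]
      rfl
  rw [h]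
  refine Prod.ext (funext fun i => funext fun p => funext fun x => ?_) (funext fun y => ?_)
  · exact run_subsetStep _ _ (fun j => getElem?_conv x u j) T
  · exact run_subsetStep _ _ (fun j => rfl) T

theorem length_conv_le {α : Type} {k T : ℕ} {u : Fin k → List α} (h : ∀ i, (u i).length ≤ T) :
    (conv u).length ≤ T := by
  simpa [conv] using h

theorem range_enc (P : M.AutomaticPresentation) : Set.range P.enc = P.domAut.language := by
  rw [← Set.image_univ]
  exact P.enc_bijOn.image_eq

theorem base_dom (P : M.AutomaticPresentation) {V : ℕ} (u u' : Fin V → List (Fin P.alphabet))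
    (T T' : ℕ) (hu : ∀ y, (u y).length ≤ T) (hu' : ∀ y, (u' y).length ≤ T')
    (h : run (baseStep P V) (baseInit P V) u T = run (baseStep P V) (baseInit P V) u' T')
    (y : Fin V) (hy : u y ∈ Set.range P.enc) : u' y ∈ Set.range P.enc := by
  rw [run_base, run_base] at h
  have h₂ := congrFun (congrArg Prod.snd h) y
  simp only [List.take_of_length_le (hu y), List.take_of_length_le (hu' y)] at h₂
  rw [range_enc] at hy ⊢
  obtain ⟨q, hq, hq'⟩ := (P.domAut.mem_language_iff _).1 hy
  exact (P.domAut.mem_language_iff _).2 ⟨q, hq, h₂ ▸ hq'⟩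

theorem base_atomEquiv (P : M.AutomaticPresentation) {V : ℕ} (ν ν' : ℕ → D)
    (T T' : ℕ) (hT : ∀ y : Fin V, (P.enc (ν y)).length ≤ T)
    (hT' : ∀ y : Fin V, (P.enc (ν' y)).length ≤ T')
    (h : run (baseStep P V) (baseInit P V) (fun y => P.enc (ν y)) T =
      run (baseStep P V) (baseInit P V) (fun y => P.enc (ν' y)) T') : AtomEquiv M V ν ν' := by
  intro w p x hx
  obtain ⟨i, rfl⟩ := P.world.surjective w
  rw [run_base, run_base] at h
  have h₁ := congrFun (congrFun (congrFun (congrArg Prod.fst h) i) p) fun j => ⟨x j, hx j⟩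
  simp only at h₁
  rw [List.take_of_length_le (length_conv_le fun j => hT ⟨x j, hx j⟩),
    List.take_of_length_le (length_conv_le fun j => hT' ⟨x j, hx j⟩)] at h₁
  rw [P.enc_interp, P.enc_interp, FinAut.mem_language_iff, FinAut.mem_language_iff, h₁]

theorem card_baseState_le (P : M.AutomaticPresentation) {Z V : ℕ} (hV : 0 < V)
    (hw : P.numWorlds ≤ Z) (hp : σ.numPred ≤ Z) (har : ∀ p, σ.arity p ≤ Z)
    (hs : ∀ i p, (P.predAut i p).numStates ≤ Z) (hd : P.domAut.numStates ≤ Z) :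
    Nat.card (BaseState P V) ≤ baseBound Z V := by
  classical
  have hprod : ∀ {m k b : ℕ} {f : Fin m → ℕ}, m ≤ k → 0 < b → (∀ i, f i ≤ b) →
      ∏ i, f i ≤ b ^ k := by
    intro m k b f hmk hb hf
    calc ∏ i, f i ≤ ∏ _i : Fin m, b := Finset.prod_le_prod' fun i _ => hf i
      _ = b ^ m := by simp
      _ ≤ b ^ k := Nat.pow_le_pow_right hb hmk
  rw [Nat.card_eq_fintype_card, Fintype.card_prod, Fintype.card_pi, Fintype.card_fun,
    Fintype.card_set, Fintype.card_fin, Fintype.card_fin]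
  refine Nat.mul_le_mul (hprod hw (by positivity) fun i => ?_)
    (Nat.pow_le_pow_left (Nat.pow_le_pow_right two_pos hd) _)
  rw [Fintype.card_pi]
  refine hprod hp (by positivity) fun p => ?_
  rw [Fintype.card_fun, Fintype.card_set, Fintype.card_fun, Fintype.card_fin, Fintype.card_fin,
    Fintype.card_fin]
  exact (Nat.pow_le_pow_left (Nat.pow_le_pow_right two_pos (hs i p)) _).trans
    (Nat.pow_le_pow_right (by positivity) (Nat.pow_le_pow_right hV (har p)))

end BaseAutomaton

/-! ### Correctness of the elementary procedures -/

section Lists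

theorem mem_tuples {β : Type*} {l : List β} {k : ℕ} {w : List β} :
    w ∈ tuples l k ↔ w.length = k ∧ ∀ b ∈ w, b ∈ l := by
  induction k generalizing w with
  | zero =>
    change w ∈ [[]] ↔ _
    simp only [List.mem_singleton, List.length_eq_zero_iff]
    exact ⟨fun h => ⟨h, by simp [h]⟩, fun h => h.1⟩
  | succ k ih =>
    change w ∈ l.flatMap (fun b => (tuples l k).map fun w => b :: w) ↔ _
    simp only [List.mem_flatMap, List.mem_map, ih]
    constructor
    · rintro ⟨b, hb, w, ⟨hw, hl⟩, rfl⟩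
      exact ⟨by simp [hw], by simpa [hb] using hl⟩
    · rintro ⟨hw, hl⟩
      cases w with
      | nil => simp at hw
      | cons b w =>
        exact ⟨b, hl b (by simp), w, ⟨by simpa using hw, fun b' hb' => hl b' (by simp [hb'])⟩, rfl⟩

theorem mem_pairs {β γ : Type*} {l : List β} {l' : List γ} {x : β × γ} :
    x ∈ pairs l l' ↔ x.1 ∈ l ∧ x.2 ∈ l' := by
  obtain ⟨b, c⟩ := x
  simp [pairs]

theorem mem_wordsLE {a k : ℕ} {w : List ℕ} :
    w ∈ wordsLE a k ↔ w.length ≤ k ∧ ∀ b ∈ w, b < a := by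
  simp [wordsLE, mem_tuples]

theorem getD_ofFn {β : Type*} {k : ℕ} (f : Fin k → β) (i : Fin k) (d : β) :
    (List.ofFn f).getD i d = f i := by
  simp [List.getD_eq_getElem?_getD]

theorem relLookup_relCode {n m : ℕ} (R : Fin n → Fin m → Fin m → Prop) (a : Fin n) (i j : Fin m) :
    relLookup (relCode R) a i j = true ↔ R a i j := by
  simp only [relLookup, relCode, getD_ofFn, decide_eq_true_iff]

theorem foldl_max_eq {β : Type*} {k : ℕ} (u : Fin k → List β) :
    (List.ofFn u).foldl (fun m w => max m w.length) 0 = Finset.univ.sup fun i => (u i).length := by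
  have h : ∀ (l : List (List β)) (a m : ℕ), l.foldl (fun m w => max m w.length) a ≤ m ↔
      a ≤ m ∧ ∀ w ∈ l, w.length ≤ m := by
    intro l
    induction l with
    | nil => simp
    | cons b l ih => intro a m; simp [ih, and_assoc]
  refine eq_of_forall_ge_iff fun m => ?_
  rw [h, Finset.sup_le_iff]
  simp

theorem convCode_ofFn {A k : ℕ} (u : Fin k → List (Fin A)) :
    convCode (List.ofFn fun i => (u i).map fun b : Fin A => (b : ℕ)) =
      (conv u).map fun l => List.ofFn fun j => (l j).map fun b : Fin A => (b : ℕ) := by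
  simp only [convCode, foldl_max_eq, conv, List.map_map, List.length_map]
  refine List.map_congr_left fun j _ => ?_
  simp [List.map_ofFn, Function.comp_def]

theorem FinAut.code_eq {A L : Type} (letter : A → L) (𝒜 : FinAut A) :
    𝒜.code letter = (𝒜.numStates, 𝒜.start.map Fin.val, 𝒜.accept.map Fin.val,
      𝒜.trans.map fun t => (t.1.val, letter t.2.1, t.2.2.val)) := by
  have h : ∀ l : List (Fin 𝒜.numStates),
      (do let a ← l; pure (a : ℕ) : List ℕ) = l.map Fin.val := fun l => List.flatMap_pure_eq_map _ _
  simp only [FinAut.code, h, List.map_map]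
  rfl

theorem FinAut.accepts_code {A L : Type} [DecidableEq L] {letter : A → L}
    (hl : Function.Injective letter) (𝒜 : FinAut A) (w : List A) :
    AutCode.accepts (𝒜.code letter) (w.map letter) = true ↔ w ∈ 𝒜.language := by
  have key : ∀ (w : List A) (S : List ℕ) (X : Set (Fin 𝒜.numStates)),
      (∀ q : ℕ, q ∈ S ↔ ∃ q' ∈ X, (q' : ℕ) = q) →
      ∀ q : ℕ, q ∈ (w.map letter).foldl (fun S a => AutCode.step (𝒜.code letter) S a) S ↔
        ∃ q' ∈ 𝒜.nfa.evalFrom X w, (q' : ℕ) = q := by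
    intro w
    induction w with
    | nil => intro S X h; simpa using h
    | cons a w ih =>
      intro S X h
      rw [List.map_cons, List.foldl_cons, NFA.evalFrom_cons]
      refine ih _ _ fun q => ?_
      simp only [AutCode.step, FinAut.code_eq, List.mem_map, List.mem_filter, Bool.and_eq_true,
        memB_iff, beq_iff_eq, NFA.mem_stepSet]
      constructor
      · rintro ⟨_, ⟨⟨⟨p, b, q'⟩, ht, rfl⟩, hp, hb⟩, rfl⟩
        obtain ⟨p', hp', hpp⟩ := (h _).1 hp
        obtain rfl := Fin.ext hpp
        obtain rfl := hl hb
        exact ⟨q', ⟨p', hp', ht⟩, rfl⟩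
      · rintro ⟨q', ⟨p, hp, ht⟩, rfl⟩
        exact ⟨_, ⟨⟨(p, a, q'), ht, rfl⟩, (h _).2 ⟨p, hp, rfl⟩, rfl⟩, rfl⟩
  rw [AutCode.accepts, FinAut.mem_language_iff]
  simp only [List.any_eq_true, memB_iff]
  have hk := key w (𝒜.code letter).2.1 𝒜.nfa.start (fun q => by
    simp only [FinAut.code_eq, List.mem_map]
    exact Iff.rfl)
  constructor
  · rintro ⟨q, hq, ha⟩
    obtain ⟨q', hq', rfl⟩ := (hk q).1 hq
    simp only [FinAut.code_eq, List.mem_map] at ha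
    obtain ⟨p, hp, hpq⟩ := ha
    obtain rfl := Fin.ext hpq
    exact ⟨p, hp, hq'⟩
  · rintro ⟨q, ha, hq⟩
    exact ⟨q, (hk q).2 ⟨q, hq, rfl⟩, by
      rw [FinAut.code_eq]
      exact List.mem_map.2 ⟨q, ha, rfl⟩⟩

end Lists

/-! ### Correctness of the evaluator -/

section Evaluator

variable {σ : Signature} {n : ℕ} {D : Type u}

/-- The list of the values, as words, of the first `V` variables. -/
def assignCode (word : D → List ℕ) (V : ℕ) (ν : ℕ → D) : List (List ℕ) :=
  (List.range V).map fun y => word (ν y)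

variable {word : D → List ℕ} {V : ℕ}

theorem getD_assignCode {ν : ℕ → D} {x : ℕ} (hx : x < V) :
    (assignCode word V ν).getD x [] = word (ν x) := by
  simp [assignCode, List.getD_eq_getElem?_getD, hx]

theorem set_assignCode (ν : ℕ → D) (x : ℕ) (d : D) :
    (assignCode word V ν).set x (word d) = assignCode word V (Function.update ν x d) := by
  refine List.ext_getElem? fun y => ?_
  rw [List.getElem?_set]
  simp only [assignCode, List.length_map, List.length_range, List.getElem?_map]
  by_cases hxy : x = y
  · subst hxy
    by_cases hx : x < V
    · simp [hx]
    · simp [hx]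
  · by_cases hy : y < V
    · simp [hxy, hy, Function.update_of_ne (Ne.symm hxy)]
    · simp [hxy, hy]

theorem mem_tuples_iff_assignCode [Nonempty D] {l : List (List ℕ)} {ℓ : ℕ}
    (hl : ∀ w, w ∈ l ↔ ∃ d, (word d).length ≤ ℓ ∧ word d = w) {v : List (List ℕ)} :
    v ∈ tuples l V ↔ ∃ ν : ℕ → D, (∀ y < V, (word (ν y)).length ≤ ℓ) ∧ assignCode word V ν = v := by
  rw [mem_tuples]
  constructor
  · rintro ⟨hv, hm⟩
    have h : ∀ y : ℕ, ∃ d : D, y < V → (word d).length ≤ ℓ ∧ some (word d) = v[y]? := by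
      intro y
      by_cases hy : y < V
      · obtain ⟨d, hd, hw⟩ := (hl _).1 (hm v[y] (List.getElem_mem _))
        exact ⟨d, fun _ => ⟨hd, by simp [hw]⟩⟩
      · exact ⟨Classical.arbitrary D, fun h => absurd h hy⟩
    choose ν hν using h
    refine ⟨ν, fun y hy => (hν y hy).1, List.ext_getElem? fun y => ?_⟩
    by_cases hy : y < V
    · rw [← (hν y hy).2]
      simp [assignCode, hy]
    · rw [List.getElem?_eq_none (by simpa [assignCode] using hy), List.getElem?_eq_none (by omega)]
  · rintro ⟨ν, hν, rfl⟩
    refine ⟨by simp [assignCode], fun b hb => ?_⟩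
    simp only [assignCode, List.mem_map, List.mem_range] at hb
    obtain ⟨y, hy, rfl⟩ := hb
    exact (hl _).2 ⟨ν y, hν y hy, rfl⟩

/-- The table model `m` agrees with the epistemic model `K`, whose worlds are named by `name` and
whose elements are coded by `word`, as far as words of length at most `L` are concerned. -/
structure Represents (word : D → List ℕ) (L : ℕ) (K : EpistemicModel.{u, v} σ n D)
    (name : K.World → List ℕ) (m : TableModel) : Prop where
  name_injective : Function.Injective name
  mem_worlds : ∀ v, v ∈ m.1 ↔ ∃ w, name w = v
  mem_rel : ∀ (a : Fin n) (w w' : K.World), ((a : ℕ), name w, name w') ∈ m.2.1 ↔ K.rel a w w'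
  mem_atoms : ∀ (w : K.World) (p : Fin σ.numPred) (d : Fin (σ.arity p) → D),
    (∀ i, (word (d i)).length ≤ L) →
      ((name w, (p : ℕ), List.ofFn fun i => word (d i)) ∈ m.2.2 ↔ d ∈ K.interp w p)

/-- The table `T` lists the pairs of a world and an assignment of words of length at most `ℓ` at
which `φ` is true. -/
structure IsExtension (word : D → List ℕ) (V ℓ : ℕ) (K : EpistemicModel.{u, v} σ n D)
    (name : K.World → List ℕ) (φ : Formula σ n) (T : Table) : Prop where
  mem_iff : ∀ (w : K.World) (ν : ℕ → D), (∀ y < V, (word (ν y)).length ≤ ℓ) →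
    ((name w, assignCode word V ν) ∈ T ↔ Sat K w ν φ)
  exists_of_mem : ∀ x ∈ T, ∃ (w : K.World) (ν : ℕ → D), (∀ y < V, (word (ν y)).length ≤ ℓ) ∧
    x = (name w, assignCode word V ν)

theorem Represents.isExtension_filter [Nonempty D] {L ℓ : ℕ} {K : EpistemicModel.{u, v} σ n D}
    {name : K.World → List ℕ} {m : TableModel} (h : Represents word L K name m)
    {l : List (List ℕ)} (hl : ∀ w, w ∈ l ↔ ∃ d, (word d).length ≤ ℓ ∧ word d = w)
    {φ : Formula σ n} {f : List ℕ × List (List ℕ) → Bool}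
    (hf : ∀ (w : K.World) (ν : ℕ → D), (∀ y < V, (word (ν y)).length ≤ ℓ) →
      (f (name w, assignCode word V ν) = true ↔ Sat K w ν φ)) :
    IsExtension word V ℓ K name φ ((pairs m.1 (tuples l V)).filter f) := by
  refine ⟨fun w ν hν => ?_, fun x hx => ?_⟩
  · rw [List.mem_filter, mem_pairs, hf w ν hν, and_iff_right]
    exact ⟨(h.mem_worlds _).2 ⟨w, rfl⟩, (mem_tuples_iff_assignCode hl).2 ⟨ν, hν, rfl⟩⟩
  · obtain ⟨hw, hv⟩ := mem_pairs.1 (List.mem_filter.1 hx).1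
    obtain ⟨w, hw⟩ := (h.mem_worlds _).1 hw
    obtain ⟨ν, hν, hv⟩ := (mem_tuples_iff_assignCode hl).1 hv
    exact ⟨w, ν, hν, Prod.ext hw.symm hv.symm⟩

theorem evalSymbol_atom (c : InputCode) (m : TableModel) (k : ℕ) (st : List Table) (p : ℕ)
    (xs : List ℕ) (x : List ℕ × List (List ℕ)) : evalSymbol c m k st (0, p :: xs) x =
      memB (x.1, p, xs.map fun i => x.2.getD i []) m.2.2 :=
  rfl

theorem evalSymbol_neg (c : InputCode) (m : TableModel) (k : ℕ) (T : Table) (st : List Table)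
    (l : List ℕ) (x : List ℕ × List (List ℕ)) :
    evalSymbol c m k (T :: st) (1, l) x = !memB x T :=
  rfl

theorem evalSymbol_conj (c : InputCode) (m : TableModel) (k : ℕ) (T T' : Table)
    (st : List Table) (l : List ℕ) (x : List ℕ × List (List ℕ)) :
    evalSymbol c m k (T :: T' :: st) (2, l) x = (memB x T' && memB x T) :=
  rfl

theorem evalSymbol_all (c : InputCode) (m : TableModel) (k : ℕ) (T : Table) (st : List Table)
    (i : ℕ) (x : List ℕ × List (List ℕ)) : evalSymbol c m k (T :: st) (3, [i]) x =
      (c.domWords k).all fun d => memB (x.1, x.2.set i d) T :=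
  rfl

theorem evalSymbol_box (c : InputCode) (m : TableModel) (k : ℕ) (T : Table) (st : List Table)
    (a : ℕ) (x : List ℕ × List (List ℕ)) : evalSymbol c m k (T :: st) (4, [a]) x =
      m.1.all fun w => !memB (a, x.1, w) m.2.1 || memB (w, x.2) T :=
  rfl

/-- The evaluator computes the extensions of formulas. The hypothesis `hφ` says that there are no
quantifiers, or else that witnesses for quantifiers need not be longer than the evaluator allows. -/
theorem Represents.foldl_evalStep [Nonempty D] {c : InputCode} {L base step r : ℕ}
    {K : EpistemicModel.{u, v} σ n D} {name : K.World → List ℕ} {m : TableModel}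
    (hdom : ∀ ℓ w, w ∈ c.domWords ℓ ↔ ∃ d, (word d).length ≤ ℓ ∧ word d = w)
    (h : Represents word L K name m) (φ : Formula σ n) (hV : φ.VarsLT V)
    (hφ : φ.QuantifierFree ∨
      HasShortWitnesses K (fun d => (word d).length) V step r ∧ φ.quantDepth ≤ r) :
    ∀ (t : ℕ) (st : List Table), base + (t + φ.code.length) * step ≤ L →
      ∃ T, φ.code.foldl (fun st s => evalStep c V m base step st s) (t + φ.code.length, st) =
        (t, T :: st) ∧ IsExtension word V (base + t * step) K name φ T := by
  have hmono : ∀ t, base + t * step ≤ base + (t + 1) * step := fun t =>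
    Nat.add_le_add_left (Nat.mul_le_mul_right _ (Nat.le_succ t)) _
  induction φ with
  | atom p x =>
    intro t st hL
    refine ⟨_, rfl, h.isExtension_filter (hdom _) fun w ν hν => ?_⟩
    have hargs : ((List.ofFn x).map fun i => (assignCode word V ν).getD i []) =
        List.ofFn fun i => word (ν (x i)) := by
      rw [List.map_ofFn]
      congr 1
      funext i
      exact getD_assignCode (hV i)
    have := h.mem_atoms w p (fun i => ν (x i)) fun i =>
      (hν _ (hV i)).trans ((hmono t).trans hL)
    rw [evalSymbol_atom, hargs, memB_iff, this, Sat]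
  | neg φ ih =>
    intro t st hL
    have hlen : t + (Formula.neg φ).code.length = t + 1 + φ.code.length := by
      simp [Formula.code]; omega
    rw [hlen] at hL ⊢
    obtain ⟨T, hT, hext⟩ := ih hV hφ (t + 1) st hL
    rw [Formula.code, List.foldl_append, hT]
    refine ⟨_, rfl, h.isExtension_filter (hdom _) fun w ν hν => ?_⟩
    have := hext.mem_iff w ν fun y hy => (hν y hy).trans (hmono t)
    rw [evalSymbol_neg, Sat, ← this, ← memB_iff, Bool.not_eq_true', Bool.not_eq_true]
  | conj φ ψ ih₁ ih₂ =>
    intro t st hL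
    have hlen : t + (Formula.conj φ ψ).code.length =
        t + 1 + ψ.code.length + φ.code.length := by
      simp [Formula.code]; omega
    rw [hlen] at hL ⊢
    obtain ⟨T₁, hT₁, hext₁⟩ := ih₁ hV.1
      (hφ.imp (fun h => h.1) fun h => ⟨h.1, (le_max_left _ _).trans h.2⟩)
      (t + 1 + ψ.code.length) st hL
    obtain ⟨T₂, hT₂, hext₂⟩ := ih₂ hV.2
      (hφ.imp (fun h => h.2) fun h => ⟨h.1, (le_max_right _ _).trans h.2⟩)
      (t + 1) (T₁ :: st) ((Nat.add_le_add_left (Nat.mul_le_mul_right _ (by omega)) _).trans hL)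
    rw [Formula.code, List.foldl_append, List.foldl_append, hT₁, hT₂]
    refine ⟨_, rfl, h.isExtension_filter (hdom _) fun w ν hν => ?_⟩
    have h₁ := hext₁.mem_iff w ν fun y hy => (hν y hy).trans
      (Nat.add_le_add_left (Nat.mul_le_mul_right _ (by omega)) _)
    have h₂ := hext₂.mem_iff w ν fun y hy => (hν y hy).trans (hmono t)
    rw [evalSymbol_conj, Sat, ← h₁, ← h₂, Bool.and_eq_true, memB_iff, memB_iff]
  | all x φ ih =>
    intro t st hL
    have hlen : t + (Formula.all x φ).code.length = t + 1 + φ.code.length := by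
      simp [Formula.code]; omega
    rw [hlen] at hL ⊢
    obtain ⟨hsw, hr⟩ := hφ.resolve_left id
    have hr' : φ.quantDepth ≤ r := (Nat.le_succ _).trans hr
    obtain ⟨T, hT, hext⟩ := ih hV.2 (Or.inr ⟨hsw, hr'⟩) (t + 1) st hL
    rw [Formula.code, List.foldl_append, hT]
    refine ⟨_, rfl, h.isExtension_filter (hdom _) fun w ν hν => ?_⟩
    have hstep : base + (t + 1) * step = base + t * step + step := by ring
    have hT : ∀ d, (word d).length ≤ base + (t + 1) * step →
        ((name w, (assignCode word V ν).set x (word d)) ∈ T ↔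
          Sat K w (Function.update ν x d) φ) := by
      intro d hd
      rw [set_assignCode]
      refine hext.mem_iff w _ fun y hy => ?_
      by_cases hyx : y = x
      · subst hyx; simpa using hd
      · simpa [hyx] using (hν y hy).trans (hmono t)
    have hiff : evalSymbol c m (base + (t + 1) * step) (T :: st) (3, [x])
        (name w, assignCode word V ν) = true ↔
          ∀ d, (word d).length ≤ base + (t + 1) * step → Sat K w (Function.update ν x d) φ := by
      simp only [evalSymbol_all, List.all_eq_true, memB_iff, hdom]
      constructor
      · intro H d hd
        exact (hT d hd).1 (H _ ⟨d, hd, rfl⟩)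
      · rintro H _ ⟨d, hd, rfl⟩
        exact (hT d hd).2 (H d hd)
    refine hiff.trans ⟨fun H d => ?_, fun H d _ => H d⟩
    -- Shorten the value `d` of `x`; the other values are short and do not change.
    obtain ⟨ν', hge, hfix, hle, hsat⟩ :=
      hsw φ hV.2 hr' w (Function.update ν x d) (base + t * step)
    have hν' : ν' = Function.update ν x (ν' x) := by
      funext y
      by_cases hyx : y = x
      · subst hyx; simp
      · rw [Function.update_of_ne hyx]
        by_cases hy : y < V
        · rw [hfix y (by simpa [hyx] using hν y hy), Function.update_of_ne hyx]
        · rw [hge y (not_lt.1 hy), Function.update_of_ne hyx]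
    rw [hsat, hν']
    exact H _ ((hle x hV.1).trans hstep.ge)
  | box a φ ih =>
    intro t st hL
    have hlen : t + (Formula.box a φ).code.length = t + 1 + φ.code.length := by
      simp [Formula.code]; omega
    rw [hlen] at hL ⊢
    obtain ⟨T, hT, hext⟩ := ih hV hφ (t + 1) st hL
    rw [Formula.code, List.foldl_append, hT]
    refine ⟨_, rfl, h.isExtension_filter (hdom _) fun w ν hν => ?_⟩
    have hT' := fun w' => hext.mem_iff w' ν fun y hy => (hν y hy).trans (hmono t)
    simp only [evalSymbol_box, List.all_eq_true, h.mem_worlds, Bool.or_eq_true,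
      Bool.not_eq_true', ← Bool.not_eq_true, memB_iff, Sat, forall_exists_index,
      forall_apply_eq_imp_iff, h.mem_rel, hT', ← imp_iff_not_or]

theorem Represents.isExtension_evalCode [Nonempty D] {c : InputCode} {L base step r : ℕ}
    {K : EpistemicModel.{u, v} σ n D} {name : K.World → List ℕ} {m : TableModel}
    (hdom : ∀ ℓ w, w ∈ c.domWords ℓ ↔ ∃ d, (word d).length ≤ ℓ ∧ word d = w)
    (h : Represents word L K name m) (φ : Formula σ n) (hV : φ.VarsLT V)
    (hφ : φ.QuantifierFree ∨
      HasShortWitnesses K (fun d => (word d).length) V step r ∧ φ.quantDepth ≤ r)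
    (hL : base + φ.code.length * step ≤ L) :
    IsExtension word V base K name φ (evalCode c V m base step φ.code) := by
  obtain ⟨T, hT, hext⟩ := h.foldl_evalStep hdom φ hV hφ (base := base) 0 [] (by simpa using hL)
  rw [zero_add] at hT
  rw [evalCode, hT]
  simpa using hext

theorem Represents.holdsCode_iff [Nonempty D] {c : InputCode} {L N r : ℕ}
    {K : EpistemicModel.{u, v} σ n D} {name : K.World → List ℕ} {m : TableModel}
    (hdom : ∀ ℓ w, w ∈ c.domWords ℓ ↔ ∃ d, (word d).length ≤ ℓ ∧ word d = w)
    (h : Represents word L K name m) (φ : Formula σ n) (hV : φ.VarsLT V)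
    (hsw : HasShortWitnesses K (fun d => (word d).length) V N r) (hr : φ.quantDepth ≤ r)
    (hL : N + φ.code.length * N ≤ L) (w : K.World) :
    holdsCode c V m N φ.code (name w) = true ↔ Holds K w φ := by
  have hext := h.isExtension_evalCode hdom φ hV (Or.inr ⟨hsw, hr⟩) hL
  simp only [holdsCode, List.all_eq_true, memB_iff]
  constructor
  · intro H ν
    obtain ⟨ν', -, -, hle, hsat⟩ := hsw φ hV hr w ν 0
    have hle' : ∀ y < V, (word (ν' y)).length ≤ N := fun y hy => by simpa using hle y hy
    exact hsat.2 ((hext.mem_iff w ν' hle').1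
      (H _ ((mem_tuples_iff_assignCode (hdom N)).2 ⟨ν', hle', rfl⟩)))
  · intro H v hv
    obtain ⟨ν, hν, rfl⟩ := (mem_tuples_iff_assignCode (hdom N)).1 hv
    exact (hext.mem_iff w ν hν).2 (H ν)

end Evaluator

/-! ### Correctness of the tables of iterated updates -/

section Tables

variable {σ : Signature} {n : ℕ} {D : Type u} {M : EpistemicModel.{u, v} σ n D}

/-- The code of an element of the domain, as a word over the natural numbers. -/
def wordCode (P : M.AutomaticPresentation) (d : D) : List ℕ := (P.enc d).map Fin.val

theorem wordCode_injective (P : M.AutomaticPresentation) : Function.Injective (wordCode P) :=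
  (List.map_injective_iff.2 Fin.val_injective).comp (Set.injOn_univ.1 P.enc_bijOn.injOn)

theorem length_wordCode (P : M.AutomaticPresentation) (d : D) :
    (wordCode P d).length = (P.enc d).length :=
  List.length_map _

theorem mem_domWords (P : M.AutomaticPresentation) (w₀ : M.World) (E : ActionModel σ n)
    (goal : Formula σ n) (ℓ : ℕ) (w : List ℕ) :
    w ∈ (inputCode M P w₀ E goal).domWords ℓ ↔
      ∃ d, (wordCode P d).length ≤ ℓ ∧ wordCode P d = w := by
  have hacc := fun l => FinAut.accepts_code Fin.val_injective P.domAut l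
  have hcode : (inputCode M P w₀ E goal).domAut = P.domAut.code Fin.val := rfl
  rw [InputCode.domWords, List.mem_filter, mem_wordsLE, hcode]
  constructor
  · rintro ⟨⟨hw, hl⟩, ha⟩
    have hl' : ∀ b ∈ w, b < P.alphabet := hl
    obtain ⟨l, rfl⟩ : ∃ l : List (Fin P.alphabet), l.map Fin.val = w :=
      ⟨w.pmap Fin.mk hl', by simp [List.map_pmap]⟩
    have hm := (hacc l).1 ha
    have hm' : l ∈ Set.range P.enc := by rwa [range_enc]
    obtain ⟨d, rfl⟩ := hm'
    exact ⟨d, hw, rfl⟩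
  · rintro ⟨d, hd, rfl⟩
    refine ⟨⟨hd, fun b hb => ?_⟩, (hacc _).2 ?_⟩
    · obtain ⟨a, -, rfl⟩ := List.mem_map.1 hb
      exact a.2
    · have : P.enc d ∈ Set.range P.enc := ⟨d, rfl⟩
      rwa [range_enc] at this

/-- The coding of the letters of the automata of the predicates. -/
def letterCode {A k : ℕ} (l : Fin k → Option (Fin A)) : List (Option ℕ) :=
  List.ofFn fun j => (l j).map Fin.val

theorem letterCode_injective {A k : ℕ} : Function.Injective (letterCode (A := A) (k := k)) := by
  intro l l' h
  funext j
  exact Option.map_injective Fin.val_injective (congrFun (List.ofFn_injective h) j)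

theorem getD_predAuts (P : M.AutomaticPresentation) (w₀ : M.World) (E : ActionModel σ n)
    (goal : Formula σ n) (i : Fin P.numWorlds) (p : Fin σ.numPred) :
    ((inputCode M P w₀ E goal).predAuts.getD i []).getD p (0, [], [], []) =
      (P.predAut i p).code letterCode := by
  simp only [InputCode.predAuts, inputCode, getD_ofFn]
  congr 1
  funext l
  refine congrArg List.ofFn (funext fun j => ?_)
  cases l j <;> rfl

/-- The presented model agrees with its table. -/
theorem represents_baseTable (P : M.AutomaticPresentation) (w₀ : M.World) (E : ActionModel σ n)
    (goal : Formula σ n) (L : ℕ) :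
    Represents (wordCode P) L M (fun w => [(P.world.symm w : ℕ)])
      (baseTable (inputCode M P w₀ E goal) L) := by
  have hlen : (inputCode M P w₀ E goal).predAuts.length = P.numWorlds := List.length_ofFn
  have hW : ∀ v, v ∈ (baseTable (inputCode M P w₀ E goal) L).1 ↔
      ∃ w, [(P.world.symm w : ℕ)] = v := by
    intro v
    simp only [baseTable, hlen, List.mem_map, List.mem_range]
    constructor
    · rintro ⟨i, hi, rfl⟩
      exact ⟨P.world ⟨i, hi⟩, by simp⟩
    · rintro ⟨w, rfl⟩
      exact ⟨_, (P.world.symm w).2, rfl⟩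
  refine ⟨fun w w' h => ?_, hW, fun a w w' => ?_, fun w p d hd => ?_⟩
  · simpa [Fin.ext_iff.symm] using h
  · have hR := relLookup_relCode (fun a i j => M.rel a (P.world i) (P.world j)) a
      (P.world.symm w) (P.world.symm w')
    simp only [Equiv.apply_symm_apply] at hR
    change _ ∈ List.filter _ (pairs (List.range n) (pairs (baseTable (inputCode M P w₀ E goal) L).1
      (baseTable (inputCode M P w₀ E goal) L).1)) ↔ _
    rw [List.mem_filter, mem_pairs, mem_pairs, hW, hW, List.mem_range]
    exact ⟨fun h => hR.1 h.2, fun h => ⟨⟨a.2, ⟨w, rfl⟩, ⟨w', rfl⟩⟩, hR.2 h⟩⟩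
  · have har : (inputCode M P w₀ E goal).arities.getD p 0 = σ.arity p := getD_ofFn σ.arity p 0
    have hpl : (inputCode M P w₀ E goal).arities.length = σ.numPred := List.length_ofFn
    have hacc : AutCode.accepts (((inputCode M P w₀ E goal).predAuts.getD (P.world.symm w) []).getD p
        (0, [], [], [])) (convCode (List.ofFn fun i => wordCode P (d i))) = true ↔
          d ∈ M.interp w p := by
      have h₁ := convCode_ofFn fun i => P.enc (d i)
      have h₂ := FinAut.accepts_code letterCode_injective (P.predAut (P.world.symm w) p)
        (conv fun i => P.enc (d i))
      have h₃ := P.enc_interp (P.world.symm w) p d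
      rw [Equiv.apply_symm_apply] at h₃
      rw [getD_predAuts, h₃, ← h₂]
      exact iff_of_eq (congrArg (fun l => AutCode.accepts _ l = true) h₁)
    change _ ∈ List.flatMap _ (baseTable (inputCode M P w₀ E goal) L).1 ↔ _
    simp only [List.mem_flatMap, List.mem_range, List.mem_map, List.mem_filter, mem_tuples,
      mem_domWords, hpl]
    constructor
    · rintro ⟨v, -, q, -, ds, ⟨-, hds⟩, he⟩
      obtain ⟨rfl, he⟩ := Prod.ext_iff.1 he
      obtain ⟨rfl, rfl⟩ := Prod.ext_iff.1 he
      exact hacc.1 hds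
    · intro h
      refine ⟨_, (hW _).2 ⟨w, rfl⟩, p, p.2, _, ⟨⟨?_, ?_⟩, hacc.2 h⟩, rfl⟩
      · rw [har, List.length_ofFn]
      · intro b hb
        obtain ⟨i, rfl⟩ := (List.mem_ofFn' _ _).1 hb
        exact ⟨d i, hd i, rfl⟩

theorem take_assignCode {word : D → List ℕ} {V k : ℕ} (hk : k ≤ V) (ν : ℕ → D) :
    (assignCode word V ν).take k = List.ofFn fun i : Fin k => word (ν i) := by
  refine List.ext_getElem? fun j => ?_
  by_cases hj : j < k
  · simp [assignCode, hj, hj.trans_le hk]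
  · rw [List.getElem?_eq_none, List.getElem?_eq_none]
    · simpa using hj
    · simp only [List.length_take]; omega

/-- The table of a product update agrees with the product update. -/
theorem Represents.updateTable [Nonempty D] (P : M.AutomaticPresentation) (w₀ : M.World)
    {E : ActionModel σ n} (goal : Formula σ n) {K : EpistemicModel.{u, v} σ n D}
    {name : K.World → List ℕ} {m : TableModel} {V N L r : ℕ}
    (hV : 0 < V) (h : Represents (wordCode P) L K name m)
    (hsw : HasShortWitnesses K (fun d => (wordCode P d).length) V N r)
    (hpreV : ∀ e, (E.pre e).VarsLT V) (hprer : ∀ e, (E.pre e).quantDepth ≤ r)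
    (hpreL : ∀ e, N + (E.pre e).code.length * N ≤ L) (hE : E.QuantifierFreePost)
    (hpostV : ∀ e p, (E.post e p).VarsLT V) (har : ∀ p, σ.arity p ≤ V) :
    Represents (wordCode P) L (K.update E) (fun x => (x.1.2 : ℕ) :: name x.1.1)
      (updateTable (inputCode M P w₀ E goal) V N L m) := by
  have hdom := mem_domWords P w₀ E goal
  have hlen : (inputCode M P w₀ E goal).pres.length = E.numEvents := List.length_ofFn
  have hpl : (inputCode M P w₀ E goal).arities.length = σ.numPred := List.length_ofFn
  have hpre : ∀ e : Fin E.numEvents, (inputCode M P w₀ E goal).pres.getD e [] = (E.pre e).code :=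
    fun e => getD_ofFn (fun e => (E.pre e).code) e []
  have hpost : ∀ (e : Fin E.numEvents) (p : Fin σ.numPred),
      ((inputCode M P w₀ E goal).posts.getD e []).getD p [] = (E.post e p).code := by
    intro e p
    simp only [InputCode.posts, inputCode, getD_ofFn]
  have hholds : ∀ (e : Fin E.numEvents) (w : K.World),
      holdsCode (inputCode M P w₀ E goal) V m N (E.pre e).code (name w) = true ↔
        Holds K w (E.pre e) := fun e w =>
    h.holdsCode_iff hdom _ (hpreV e) hsw (hprer e) (hpreL e) w
  have hW : ∀ v, v ∈ updateWorlds (inputCode M P w₀ E goal) V N m ↔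
      ∃ x : (K.update E).World, (x.1.2 : ℕ) :: name x.1.1 = v := by
    intro v
    simp only [updateWorlds, hlen, List.mem_flatMap, mem_pairs, List.mem_range]
    constructor
    · rintro ⟨⟨e, w⟩, ⟨he, hw⟩, hv⟩
      obtain ⟨w, rfl⟩ := (h.mem_worlds _).1 hw
      have hiff := hholds ⟨e, he⟩ w
      rw [← hpre] at hiff
      cases hc : holdsCode (inputCode M P w₀ E goal) V m N
        ((inputCode M P w₀ E goal).pres.getD e []) (name w) with
      | false => simp only [hc, cond_false, List.not_mem_nil] at hv
      | true =>
        simp only [hc, cond_true, List.mem_singleton] at hv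
        exact ⟨⟨(w, ⟨e, he⟩), hiff.1 hc⟩, hv.symm⟩
    · rintro ⟨⟨⟨w, e⟩, he⟩, rfl⟩
      refine ⟨(e, name w), ⟨e.2, (h.mem_worlds _).2 ⟨w, rfl⟩⟩, ?_⟩
      simp only [hpre, (hholds e w).2 he, cond_true, List.mem_singleton]
  have hinj : Function.Injective fun x : (K.update E).World => (x.1.2 : ℕ) :: name x.1.1 := by
    intro x y hxy
    obtain ⟨h₁, h₂⟩ := List.cons_eq_cons.1 hxy
    exact Subtype.ext (Prod.ext (h.name_injective h₂) (Fin.ext h₁))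
  refine ⟨hinj, hW, fun a x y => ?_, fun x p d hd => ?_⟩
  · have hR := relLookup_relCode E.rel a x.1.2 y.1.2
    change _ ∈ List.filter _ (pairs (List.range n) (pairs (updateWorlds _ _ _ _)
      (updateWorlds _ _ _ _))) ↔ _
    rw [List.mem_filter, mem_pairs, mem_pairs, hW, hW, List.mem_range, Bool.and_eq_true, memB_iff]
    exact ⟨fun H => ⟨(h.mem_rel a _ _).1 H.2.1, hR.1 H.2.2⟩,
      fun H => ⟨⟨a.2, ⟨x, rfl⟩, ⟨y, rfl⟩⟩, (h.mem_rel a _ _).2 H.1, hR.2 H.2⟩⟩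
  · have harp : (inputCode M P w₀ E goal).arities.getD p 0 = σ.arity p := getD_ofFn σ.arity p 0
    have hext := h.isExtension_evalCode hdom (E.post x.1.2 p) (hpostV _ _) (Or.inl (hE _ _))
      (base := L) (step := 0) (r := 0) (by simp)
    change _ ∈ List.flatMap _ (updateWorlds _ _ _ _) ↔ _
    simp only [List.mem_flatMap, List.mem_range, List.mem_map, List.mem_filter, beq_iff_eq, hpl]
    constructor
    · rintro ⟨v, -, q, -, z, ⟨hz, hzv⟩, he⟩
      obtain ⟨rfl, he⟩ := Prod.ext_iff.1 he
      obtain ⟨rfl, he⟩ := Prod.ext_iff.1 he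
      simp only [List.headI_cons, List.tail_cons, hpost, harp] at hz hzv he
      obtain ⟨w, ν, hν, rfl⟩ := hext.exists_of_mem z hz
      obtain rfl : w = x.1.1 := h.name_injective hzv
      simp only [take_assignCode (har p)] at he
      have hνd := fun i => wordCode_injective P (congrFun (List.ofFn_injective he) i)
      exact (mem_update_interp hνd).2 ((hext.mem_iff _ ν hν).1 hz)
    · intro hx
      obtain ⟨d₀, hd₀⟩ : ∃ d₀ : D, (wordCode P d₀).length ≤ L := by
        obtain ⟨ν', -, -, hle, -⟩ := hsw (E.pre x.1.2) (hpreV _) (hprer _) x.1.1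
          (fun _ => Classical.arbitrary D) 0
        exact ⟨ν' 0, (hle 0 hV).trans (by have := hpreL x.1.2; omega)⟩
      let ν : ℕ → D := fun i => if hi : i < σ.arity p then d ⟨i, hi⟩ else d₀
      have hν : ∀ i, (wordCode P (ν i)).length ≤ L := by
        intro i
        by_cases hi : i < σ.arity p
        · simpa only [ν, hi, dite_true] using hd _
        · simpa only [ν, hi, dite_false] using hd₀
      have hνd : ∀ i : Fin (σ.arity p), ν i = d i := fun i => by simp [ν]
      refine ⟨_, (hW _).2 ⟨x, rfl⟩, p, p.2, (name x.1.1, assignCode (wordCode P) V ν), ⟨?_, ?_⟩, ?_⟩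
      · simp only [List.headI_cons, hpost]
        exact (hext.mem_iff _ ν fun y _ => hν y).2 ((mem_update_interp hνd).1 hx)
      · rfl
      · simp only [harp, take_assignCode (har p), hνd]

/-- The name of a history: its events, the last one first, and the number of its initial world. -/
def historyName (P : M.AutomaticPresentation) (E : ActionModel σ n) :
    (k : ℕ) → (M.iterUpdate E k).World → List ℕ
  | 0, w => [(P.world.symm w : ℕ)]
  | k + 1, h => (h.1.2 : ℕ) :: historyName P E k h.1.1

theorem getD_historyName (P : M.AutomaticPresentation) (E : ActionModel σ n) :
    ∀ (k : ℕ) (h : (M.iterUpdate E k).World),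
      (historyName P E k h).getD k 0 = P.world.symm (M.root E k h)
  | 0, _ => rfl
  | k + 1, h => getD_historyName P E k h.1.1

end Tables

/-! ### The size of the input bounds all parameters -/

section Size

open Encodable

theorem encode_fst_le {α β : Type*} [Encodable α] [Encodable β] (x : α × β) :
    encode x.1 ≤ encode x :=
  Nat.left_le_pair _ _

theorem encode_snd_le {α β : Type*} [Encodable α] [Encodable β] (x : α × β) :
    encode x.2 ≤ encode x :=
  Nat.right_le_pair _ _

theorem encode_le_of_mem {α : Type*} [Encodable α] {a : α} {l : List α} (h : a ∈ l) :
    encode a ≤ encode l := by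
  induction l with
  | nil => simp at h
  | cons b l ih =>
    rw [encode_list_cons]
    rcases List.mem_cons.1 h with rfl | h
    · exact (Nat.left_le_pair _ _).trans (Nat.le_succ _)
    · exact (ih h).trans ((Nat.right_le_pair _ _).trans (Nat.le_succ _))

theorem encode_le_encode_ofFn {α : Type*} [Encodable α] {k : ℕ} (f : Fin k → α) (i : Fin k) :
    encode (f i) ≤ encode (List.ofFn f) :=
  encode_le_of_mem ((List.mem_ofFn' _ _).2 ⟨i, rfl⟩)

theorem card_le_encode_ofFn {α : Type*} [Encodable α] {k : ℕ} (f : Fin k → α) :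
    k ≤ encode (List.ofFn f) := by
  simpa using length_le_encode (List.ofFn f)

namespace Formula

variable {σ : Signature} {n : ℕ}

theorem quantDepth_le_length_code (φ : Formula σ n) : φ.quantDepth ≤ φ.code.length := by
  induction φ with
  | atom p x => exact Nat.zero_le _
  | neg φ ih => simp only [quantDepth, code, List.length_append, List.length_singleton]; omega
  | conj φ ψ ih₁ ih₂ =>
    simp only [quantDepth, code, List.length_append, List.length_singleton]; omega
  | all x φ ih => simp only [quantDepth, code, List.length_append, List.length_singleton]; omega
  | box a φ ih => simp only [quantDepth, code, List.length_append, List.length_singleton]; omega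

theorem modalDepth_le_length_code (φ : Formula σ n) : φ.modalDepth ≤ φ.code.length := by
  induction φ with
  | atom p x => exact Nat.zero_le _
  | neg φ ih => simp only [modalDepth, code, List.length_append, List.length_singleton]; omega
  | conj φ ψ ih₁ ih₂ =>
    simp only [modalDepth, code, List.length_append, List.length_singleton]; omega
  | all x φ ih => simp only [modalDepth, code, List.length_append, List.length_singleton]; omega
  | box a φ ih => simp only [modalDepth, code, List.length_append, List.length_singleton]; omega

theorem varsLT_of_mem_code {V : ℕ} (φ : Formula σ n) (h : ∀ s ∈ φ.code, ∀ i ∈ s.2, i < V) :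
    φ.VarsLT V := by
  induction φ with
  | atom p x =>
    intro i
    exact h _ (List.mem_singleton_self _) _
      (List.mem_cons_of_mem _ ((List.mem_ofFn' _ _).2 ⟨i, rfl⟩))
  | neg φ ih => exact ih fun s hs => h s (List.mem_append_left _ hs)
  | conj φ ψ ih₁ ih₂ =>
    exact ⟨ih₁ fun s hs => h s (List.mem_append_left _ (List.mem_append_left _ hs)),
      ih₂ fun s hs => h s (List.mem_append_left _ (List.mem_append_right _ hs))⟩
  | all x φ ih =>
    exact ⟨h _ (List.mem_append_right _ (List.mem_singleton_self _)) _ (List.mem_singleton_self _),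
      ih fun s hs => h s (List.mem_append_left _ hs)⟩
  | box a φ ih => exact ih fun s hs => h s (List.mem_append_left _ hs)

theorem varsLT_of_encode_le {Z : ℕ} (φ : Formula σ n) (h : encode φ.code ≤ Z) :
    φ.VarsLT (Z + 1) :=
  φ.varsLT_of_mem_code fun s hs _ hi => Nat.lt_succ_of_le <|
    ((encode_le_of_mem hi).trans ((encode_snd_le s).trans (encode_le_of_mem hs))).trans h

end Formula

end Size

/-! ### Correctness of the decision procedure -/

section Decision

open Encodable

variable {σ : Signature} {n : ℕ} {D : Type u} {M : EpistemicModel.{u, v} σ n D}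

/-- All parameters on which the bounds of the search depend are at most `Z`. -/
structure SizeLE (P : M.AutomaticPresentation) (E : ActionModel σ n) (goal : Formula σ n)
    (Z : ℕ) : Prop where
  numWorlds : P.numWorlds ≤ Z
  numPred : σ.numPred ≤ Z
  arity : ∀ p, σ.arity p ≤ Z
  agents : n ≤ Z
  predStates : ∀ i p, (P.predAut i p).numStates ≤ Z
  domStates : P.domAut.numStates ≤ Z
  pre : ∀ e, encode (E.pre e).code ≤ Z
  post : ∀ e p, encode (E.post e p).code ≤ Z
  goal : encode goal.code ≤ Z

theorem sizeLE_inputCode (P : M.AutomaticPresentation) (w : M.World) (E : ActionModel σ n)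
    (goal : Formula σ n) : SizeLE P E goal (encode (inputCode M P w E goal)) := by
  set c := inputCode M P w E goal with hc
  have h₁ : encode c.1 ≤ encode c := encode_fst_le c
  have h₂ : encode c.2 ≤ encode c := encode_snd_le c
  have h₂₁ : encode c.2.1 ≤ encode c := (encode_fst_le _).trans h₂
  have h₂₂ : encode c.2.2 ≤ encode c := (encode_snd_le _).trans h₂
  have hP : encode c.2.2.1 ≤ encode c := (encode_fst_le _).trans h₂₂
  have h₃ : encode c.2.2.2 ≤ encode c := (encode_snd_le _).trans h₂₂
  have h₄ : encode c.2.2.2.2 ≤ encode c := (encode_snd_le _).trans h₃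
  have hA : encode c.2.2.2.2.1 ≤ encode c := (encode_fst_le _).trans h₄
  have hG : encode c.2.2.2.2.2 ≤ encode c := (encode_snd_le _).trans h₄
  have hP₂ : encode c.2.2.1.2.2 ≤ encode c :=
    ((encode_snd_le _).trans (encode_snd_le _)).trans hP
  have hD : encode c.domAut ≤ encode c := (encode_fst_le _).trans hP₂
  have hR : encode c.predAuts ≤ encode c := (encode_snd_le _).trans hP₂
  have hA₂ : encode c.2.2.2.2.1.2 ≤ encode c := (encode_snd_le _).trans hA
  have hpres : encode c.pres ≤ encode c := (encode_fst_le _).trans hA₂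
  have hposts : encode c.posts ≤ encode c := (encode_snd_le _).trans hA₂
  exact {
    numWorlds := (card_le_encode_ofFn _).trans hR
    numPred := (card_le_encode_ofFn σ.arity).trans h₁
    arity := fun p => (encode_le_encode_ofFn σ.arity p).trans h₁
    agents := h₂₁
    predStates := fun i p => (encode_fst_le ((P.predAut i p).code _)).trans
      ((encode_le_encode_ofFn _ p).trans ((encode_le_encode_ofFn _ i).trans hR))
    domStates := (encode_fst_le c.domAut).trans hD
    pre := fun e => (encode_le_encode_ofFn (fun e => (E.pre e).code) e).trans hpres
    post := fun e p => (encode_le_encode_ofFn (fun p => (E.post e p).code) p).trans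
      ((encode_le_encode_ofFn (fun e => List.ofFn fun p => (E.post e p).code) e).trans hposts)
    goal := hG }

variable {P : M.AutomaticPresentation} {E : ActionModel σ n} {goal : Formula σ n}
  {Z : ℕ}

theorem SizeLE.hasShortWitnesses (h : SizeLE P E goal Z) (hE : E.NonModal)
    (hE' : E.QuantifierFreePost) (k : ℕ) : HasShortWitnesses (M.iterUpdate E k)
      (fun d => (wordCode P d).length) (Z + 1) (stateBound Z (Z + 1) Z) Z := by
  have hres : Resolves (M.iterUpdate E k) P.enc (Z + 1) 0 (baseStep P (Z + 1))
      (baseInit P (Z + 1)) :=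
    Resolves.of_atomEquiv (base_dom P) fun ν ν' T T' hT hT' hrun =>
      (base_atomEquiv P ν ν' T T' hT hT' hrun).iterUpdate (Nat.succ_pos Z) hE hE'
        (fun e p => Formula.varsLT_of_encode_le _ (h.post e p)) k
  obtain ⟨Q, hQ, δ, q₀, hcard, hr⟩ := hres.exists_iterate inferInstance
    (card_baseState_le P (Nat.succ_pos Z) h.numWorlds h.numPred h.arity h.predStates h.domStates) Z
  simp only [length_wordCode]
  exact hr.hasShortWitnesses (Set.injOn_univ.1 P.enc_bijOn.injOn) hcard

theorem add_length_code_mul_le (φ : Formula σ n) (hφ : encode φ.code ≤ Z) (N : ℕ) :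
    N + φ.code.length * N ≤ N + Z * N :=
  Nat.add_le_add_left (Nat.mul_le_mul_right _ ((length_le_encode _).trans hφ)) _

theorem quantDepth_le_of_encode_le (φ : Formula σ n) (hφ : encode φ.code ≤ Z) : φ.quantDepth ≤ Z :=
  φ.quantDepth_le_length_code.trans ((length_le_encode _).trans hφ)

theorem SizeLE.represents_iterTable [Nonempty D] (h : SizeLE P E goal Z) (w : M.World) (hE : E.NonModal)
    (hE' : E.QuantifierFreePost) {N : ℕ} (hN : N = stateBound Z (Z + 1) Z) :
    ∀ k, Represents (wordCode P) (N + Z * N) (M.iterUpdate E k) (historyName P E k)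
      (iterTable (inputCode M P w E goal) (Z + 1) N (N + Z * N) k)
  | 0 => represents_baseTable P w E goal _
  | k + 1 => (h.represents_iterTable w hE hE' hN k).updateTable P w goal (Nat.succ_pos Z)
      (hN ▸ h.hasShortWitnesses hE hE' k) (fun e => Formula.varsLT_of_encode_le _ (h.pre e))
      (fun e => quantDepth_le_of_encode_le _ (h.pre e)) (fun e => add_length_code_mul_le _ (h.pre e) N) hE'
      (fun e p => Formula.varsLT_of_encode_le _ (h.post e p))
      fun p => (h.arity p).trans (Nat.le_succ Z)

/-- If a goal can be reached at all, it can be reached by a history of bounded length. -/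
theorem SizeLE.exists_short_history [Nonempty D] (h : SizeLE P E goal Z) (hE : E.NonModal)
    (hE' : E.QuantifierFreePost) {w : M.World} (hplan : M.HasPlan w E goal) :
    ∃ k ≤ labelBound Z (Z + 1) Z, ∃ g : (M.iterUpdate E k).World,
      M.root E k g = w ∧ Holds (M.iterUpdate E k) g goal := by
  obtain ⟨⟨k, g⟩, hroot, hg⟩ := hplan
  have hg' : CanReach M E goal 0 ⟨k, g⟩ := fun ν => (sat_histories_iff goal k g ν).1 (hg ν)
  have hreach := CanReach.of_history k g 0 hroot hg'
  -- The type of an assignment is the state that the base automaton reaches on its values.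
  let len : (ℕ → D) → ℕ := fun ν => Finset.univ.sup fun y : Fin (Z + 1) => (P.enc (ν y)).length
  have hlen : ∀ (ν : ℕ → D) (y : Fin (Z + 1)), (P.enc (ν y)).length ≤ len ν := fun ν y =>
    Finset.le_sup (f := fun y : Fin (Z + 1) => (P.enc (ν y)).length) (Finset.mem_univ y)
  obtain ⟨X, hX, lab, hcard, hlab⟩ := exists_label (M := M) (E := E) (Z := Z) (V := Z + 1)
    (Nat.succ_pos Z) hE hE' (fun e p => Formula.varsLT_of_encode_le _ (h.post e p))
    (fun p => (h.arity p).trans (Nat.le_succ Z)) h.numPred h.agents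
    (card_baseState_le P (Nat.succ_pos Z) h.numWorlds h.numPred h.arity h.predStates h.domStates)
    (typ := fun ν => run (baseStep P (Z + 1)) (baseInit P (Z + 1)) (fun y => P.enc (ν y)) (len ν))
    (fun ν ν' hrun => base_atomEquiv P ν ν' _ _ (hlen ν) (hlen ν') hrun) Z
  have hm : goal.modalDepth ≤ Z :=
    goal.modalDepth_le_length_code.trans ((length_le_encode _).trans h.goal)
  obtain ⟨s, hs, hreach'⟩ := exists_short_canReach hE hm hlab hreach
  obtain ⟨⟨k', g'⟩, hk', hroot', hg'⟩ := hreach'.exists_history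
  refine ⟨k', ?_, g', hroot', hg'⟩
  simp only [zero_add] at hk'
  omega

theorem decidePlan_iff [Nonempty D] (P : M.AutomaticPresentation) (w : M.World) (E : ActionModel σ n)
    (goal : Formula σ n) (hE : E.NonModal) (hE' : E.QuantifierFreePost) :
    decidePlan (inputCode M P w E goal) = true ↔ M.HasPlan w E goal := by
  have h := sizeLE_inputCode P w E goal
  dsimp only [decidePlan]
  generalize encode (inputCode M P w E goal) = Z at h ⊢
  generalize hN : stateBound Z (Z + 1) Z = N
  have hrep := h.represents_iterTable w hE hE' hN.symm
  have hholds : ∀ (k : ℕ) (g : (M.iterUpdate E k).World),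
      holdsCode (inputCode M P w E goal) (Z + 1)
        (iterTable (inputCode M P w E goal) (Z + 1) N (N + Z * N) k) N goal.code
        (historyName P E k g) = true ↔ Holds (M.iterUpdate E k) g goal := fun k g =>
    (hrep k).holdsCode_iff (mem_domWords P w E goal) goal (Formula.varsLT_of_encode_le _ h.goal)
      (hN ▸ h.hasShortWitnesses hE hE' k) (quantDepth_le_of_encode_le _ h.goal)
      (add_length_code_mul_le _ h.goal N) g
  have hroot : ∀ (k : ℕ) (g : (M.iterUpdate E k).World),
      (historyName P E k g).getD k 0 = (inputCode M P w E goal).start ↔ M.root E k g = w := by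
    intro k g
    rw [getD_historyName]
    exact Fin.val_injective.eq_iff.trans P.world.symm.injective.eq_iff
  have hgoal : (inputCode M P w E goal).goal = goal.code := rfl
  simp only [search, List.any_eq_true, List.mem_range, Bool.and_eq_true, beq_iff_eq, hgoal]
  constructor
  · rintro ⟨k, -, v, hv, hst, hh⟩
    obtain ⟨g, rfl⟩ := ((hrep k).mem_worlds v).1 hv
    exact ⟨⟨k, g⟩, (hroot k g).1 hst, fun ν =>
      (sat_histories_iff goal k g ν).2 ((hholds k g).1 hh ν)⟩
  · intro hplan
    obtain ⟨k, hk, g, hg, hh⟩ := h.exists_short_history hE hE' hplan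
    exact ⟨k, Nat.lt_succ_of_le hk, _, ((hrep k).mem_worlds _).2 ⟨g, rfl⟩, (hroot k g).2 hg,
      (hholds k g).2 hh⟩

end Decision

end FOEpistemic

theorem mainTheorem1 :
    ∃ f : FOEpistemic.InputCode → Bool, Computable f ∧
      ∀ (σ : FOEpistemic.Signature) (n : ℕ) (D : Type u) [Nonempty D]
        (M : FOEpistemic.EpistemicModel.{u, v} σ n D) (P : M.AutomaticPresentation)
        (w : M.World) (E : FOEpistemic.ActionModel σ n) (goal : FOEpistemic.Formula σ n),
        E.NonModal → E.QuantifierFreePost →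
          (f (FOEpistemic.inputCode M P w E goal) = true ↔ M.HasPlan w E goal) :=
  ⟨FOEpistemic.decidePlan, FOEpistemic.primrec_decidePlan.to_comp,
    fun _ _ _ _ _ P w E goal hE hE' => FOEpistemic.decidePlan_iff P w E goal hE hE'⟩
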